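/- An $n$-point configuration in the plane is a tuple $p=(p_1,\dots,p_n)\in(\mathbb R^2)^n$. Its distribution of distances is the multiset of the numbers $\|p_i-p_j\|$, $1\le i<j\le n$. It is called reconstructible from distances if for every $q\in(\mathbb R^2)^n$ with the same distribution of distances there are an orthogonal matrix $M$, a vector $T\in\mathbb R^2$ and a permutation $\pi$ of $\{1,\dots,n\}$ with $Mp_i+T=q_{\pi(i)}$ for all $i$. Put $d_{\{i,j\}}=\|p_i-p_j\|^2$ and $$\begin{aligned} g(U,V,W,X,Y,Z)={}&2U^2Z+2UVX-2UVY-2UVZ-2UXW-2UXZ+2UYW-2UYZ-2UWZ+2UZ^2+2V^2Y\\&-2VXY-2VXW+2VY^2-2VYW-2VYZ+2VWZ+2X^2W-2XYW+2XYZ+2XW^2-2XWZ.\end{aligned}$$ Theorem. There are open and dense sets $\Omega_n\subset(\mathbb R^2)^n$ ($n\ge 1$) of configurations that are reconstructible from distances, and an algorithm that, given any $n\geq 1$ and any $p\in(\mathbb R^2)^n$, decides in $O(n^{11})$ steps whether $p\in\Omega_n$. Moreover, for every $n\ge 5$ this $\Omega_n$ is the set of all $p$ such that $$g\left(d_{\{i_0,i_1\}},d_{\{j_1,j_2\}},d_{\{k_1,k_2\}},d_{\{l_1,l_2\}},d_{\{m_1,m_2\}},d_{\{i_0,i_2\}}\right)\neq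 0$$ for all indices $i_0,i_1,i_2,j_1,j_2,k_1,k_2,l_1,l_2,m_1,m_2\in\{1,\dots,n\}$ for which $\{i_0,i_1\},\{i_0,i_2\},\{j_1,j_2\},\{k_1,k_2\},\{l_1,l_2\},\{m_1,m_2\}$ are six distinct two-element sets. Here an algorithm is a single program, the same for all $n$, of a random access machine over the real numbers with integer constants; it receives $n$ and the $2n$ coordinates of $p$, and every addition or assignment of natural-number indices, every addition, subtraction or multiplication of reals, every memory access and every comparison ($=$ or $<$) counts as one step. -/

import Mathlib

noncomputable section

namespace DistRec

/-- An `n`-point configuration in `ℝ^m`, with labelled points. -/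
abbrev Config (m n : ℕ) : Type := Fin n → EuclideanSpace ℝ (Fin m)

/-- The distribution of distances: the multiset of the pairwise distances, one entry for
every unordered pair of distinct labels (represented by `i < j`). -/
def distanceDistribution {m n : ℕ} (p : Config m n) : Multiset ℝ :=
  (Finset.univ.filter (fun e : Fin n × Fin n => e.1 < e.2)).val.map
    (fun e => ‖p e.1 - p e.2‖)

/-- A configuration is reconstructible from distances if every configuration with the same
distribution of distances is its image under a rigid motion (reflections included) and a
relabeling of the points. -/
def Reconstructible {m n : ℕ} (p : Config m n) : Prop :=
  ∀ q : Config m n, distanceDistribution q = distanceDistribution p →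
    ∃ (M : EuclideanSpace ℝ (Fin m) ≃ₗᵢ[ℝ] EuclideanSpace ℝ (Fin m))
      (T : EuclideanSpace ℝ (Fin m)) (π : Equiv.Perm (Fin n)),
      ∀ i, M (p i) + T = q (π i)

/-- The polynomial that vanishes on the six squared distances
`d₁₂, d₁₃, d₁₄, d₂₃, d₂₄, d₃₄` of any four points of the plane. -/
def g (U V W X Y Z : ℝ) : ℝ :=
  2 * U ^ 2 * Z + 2 * U * V * X - 2 * U * V * Y - 2 * U * V * Z - 2 * U * X * W
    - 2 * U * X * Z + 2 * U * Y * W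
    - 2 * U * Y * Z - 2 * U * W * Z + 2 * U * Z ^ 2 + 2 * V ^ 2 * Y - 2 * V * X * Y
    - 2 * V * X * W + 2 * V * Y ^ 2 - 2 * V * Y * W
    - 2 * V * Y * Z + 2 * V * W * Z + 2 * X ^ 2 * W - 2 * X * Y * W + 2 * X * Y * Z
    + 2 * X * W ^ 2 - 2 * X * W * Z

/-- The squared distance between the points labelled `i` and `j`. -/
def sqDist {m n : ℕ} (p : Config m n) (i j : Fin n) : ℝ := ‖p i - p j‖ ^ 2

/-- The inequalities of the test: `g` does not vanish on the squared distances of six distinct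
pairs of labels of which the first and the last share the label `i₀`. -/
def PassesTest {n : ℕ} (p : Config 2 n) : Prop :=
  ∀ i₀ i₁ i₂ j₁ j₂ k₁ k₂ l₁ l₂ m₁ m₂ : Fin n,
    i₀ ≠ i₁ → i₀ ≠ i₂ → j₁ ≠ j₂ → k₁ ≠ k₂ → l₁ ≠ l₂ → m₁ ≠ m₂ →
    [s(i₀, i₁), s(i₀, i₂), s(j₁, j₂), s(k₁, k₂), s(l₁, l₂), s(m₁, m₂)].Nodup →
    g (sqDist p i₀ i₁) (sqDist p j₁ j₂) (sqDist p k₁ k₂) (sqDist p l₁ l₂)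
      (sqDist p m₁ m₂) (sqDist p i₀ i₂) ≠ 0

/-! A random access machine over the real numbers, with unit costs. It has index registers
holding natural numbers, real registers, and a real memory that is addressed indirectly through
the index registers. A program is a finite expression, so that it names finitely many
registers and constants; real constants are integers. -/

/-- A state of the machine: index registers, real registers, real memory. -/
structure State where
  reg : ℕ → ℕ
  val : ℕ → ℝ
  mem : ℕ → ℝ

/-- Elementary instructions. -/
inductive Instr where
  /-- index register `x := c` -/
  | regConst (x c : ℕ)
  /-- index register `x := y + z` -/
  | regAdd (x y z : ℕ)
  /-- real register `a := c` -/
  | valConst (a : ℕ) (c : ℤ)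
  /-- real register `a := b + c` -/
  | valAdd (a b c : ℕ)
  /-- real register `a := b - c` -/
  | valSub (a b c : ℕ)
  /-- real register `a := b * c` -/
  | valMul (a b c : ℕ)
  /-- real register `a :=` the memory cell whose address is in index register `x` -/
  | load (a x : ℕ)
  /-- the memory cell whose address is in index register `x` `:=` real register `a` -/
  | store (x a : ℕ)

/-- The effect of an instruction. -/
def Instr.run : Instr → State → State
  | .regConst x c, s => { s with reg := Function.update s.reg x c }
  | .regAdd x y z, s => { s with reg := Function.update s.reg x (s.reg y + s.reg z) }
  | .valConst a c, s => { s with val := Function.update s.val a (c : ℝ) }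
  | .valAdd a b c, s => { s with val := Function.update s.val a (s.val b + s.val c) }
  | .valSub a b c, s => { s with val := Function.update s.val a (s.val b - s.val c) }
  | .valMul a b c, s => { s with val := Function.update s.val a (s.val b * s.val c) }
  | .load a x, s => { s with val := Function.update s.val a (s.mem (s.reg x)) }
  | .store x a, s => { s with mem := Function.update s.mem (s.reg x) (s.val a) }

/-- Elementary tests: comparisons of two index registers or of two real registers. -/
inductive Test where
  | regEq (x y : ℕ)
  | regLt (x y : ℕ)
  | valEq (a b : ℕ)
  | valLt (a b : ℕ)

/-- The condition checked by a test. -/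
def Test.Holds : Test → State → Prop
  | .regEq x y, s => s.reg x = s.reg y
  | .regLt x y, s => s.reg x < s.reg y
  | .valEq a b, s => s.val a = s.val b
  | .valLt a b, s => s.val a < s.val b

/-- Programs: instructions, composition, branching and loops. -/
inductive Prog where
  | skip
  | instr (i : Instr)
  | seq (A B : Prog)
  | branch (c : Test) (A B : Prog)
  | loop (c : Test) (A : Prog)

/-- `Exec A s t s'`: started in state `s`, the program `A` halts in state `s'` after exactly
`t` steps, where every executed instruction and every performed test is one step.
`loop c A` repeats `A` as long as the test `c` holds. -/
inductive Exec : Prog → State → ℕ → State → Prop where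
  | skip (s : State) : Exec .skip s 1 s
  | instr (i : Instr) (s : State) : Exec (.instr i) s 1 (i.run s)
  | seq {A B : Prog} {s s' s'' : State} {t t' : ℕ} :
      Exec A s t s' → Exec B s' t' s'' → Exec (.seq A B) s (t + t') s''
  | branchTrue {c : Test} {A B : Prog} {s s' : State} {t : ℕ} :
      c.Holds s → Exec A s t s' → Exec (.branch c A B) s (1 + t) s'
  | branchFalse {c : Test} {A B : Prog} {s s' : State} {t : ℕ} :
      ¬ c.Holds s → Exec B s t s' → Exec (.branch c A B) s (1 + t) s'
  | loopDone {c : Test} {A : Prog} {s : State} :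
      ¬ c.Holds s → Exec (.loop c A) s 1 s
  | loopStep {c : Test} {A : Prog} {s s' s'' : State} {t t' : ℕ} :
      c.Holds s → Exec A s t s' → Exec (.loop c A) s' t' s'' →
      Exec (.loop c A) s (1 + t + t') s''

/-- The initial state on input `p`: index register `0` holds the number `n` of points, the
memory holds the `2 * n` coordinates one after the other, and everything else is `0`. -/
def initState {n : ℕ} (p : Config 2 n) : State where
  reg := fun x => if x = 0 then n else 0
  val := fun _ => 0
  mem := fun a => if h : a / 2 < n then p ⟨a / 2, h⟩ ⟨a % 2, Nat.mod_lt a two_pos⟩ else 0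

/-- On every input `p` the program `A` halts after at most `N` steps, with the answer to the
question whether `p ∈ S` (`1` for yes, `0` for no) in index register `0`. -/
def DecidesWithin (A : Prog) {n : ℕ} (S : Set (Config 2 n)) (N : ℕ) : Prop :=
  ∀ p : Config 2 n, ∃ (t : ℕ) (s : State), Exec A (initState p) t s ∧ t ≤ N ∧
    (p ∈ S → s.reg 0 = 1) ∧ (p ∉ S → s.reg 0 = 0)

end DistRec

end

namespace DistRec

/-! ### Reconstruction -/

/-! If `q` has the same distances as `p`, some permutation `σ` of the pairs of labels carries the
distances of `q` to those of `p`. The polynomial `g` is, up to sign, the Cayley–Menger determinant,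
so it vanishes on the six squared distances of any four points of `q`, that is, on the squared
distances in `p` of the six image pairs. The test says that `g` does not vanish when its first and
last arguments come from incident pairs. Hence `σ` keeps disjoint pairs disjoint
(`PassesTest.disjoint_of_pairDist_eq`) and, by finiteness, incident pairs incident.

Such a `σ` comes from a permutation of the labels unless it sends three pairs at one label to a
triangle (`exists_perm_of_meets`). For `n ≥ 5` a fourth pair at that label rules this out. For `n =
4` the exception is real; by `g_swap_sub` it forces two opposite sides to be equal, which
`OppositeSidesDiffer` forbids. For `n ≤ 3` every `σ` is induced. Once the labels match, equal
distances give a rigid motion.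

Each condition is the nonvanishing of a polynomial on configurations, so openness and density need
only one point where it is nonzero. Configurations with only two distinct positions suffice
(`exists_cut`, `g_indicator_ne_zero`).

The program runs the test in eleven nested loops with a body of constant cost and records a failure
in a flag; `Raises` is the invariant that composes. -/

theorem exists_perm_of_map_eq {α β : Type*} {s : Finset α} {f g : α → β}
    (h : s.val.map f = s.val.map g) : ∃ σ : Equiv.Perm s, ∀ a, g (σ a) = f a := by
  classical
  have key : ∀ (f : α → β) (c : β),
      Fintype.card {a : s // f a = c} = Multiset.count c (s.val.map f) := by
    intro f c
    rw [Multiset.count_map, Fintype.card_subtype, ← Finset.filter_val, Finset.card_val]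
    rw [← Finset.card_map (Function.Embedding.subtype _)]
    congr 1
    ext a
    simp [eq_comm]
    tauto
  -- Fibres over the same value have the same cardinality, so bijections between them glue to a
  -- permutation.
  have e : ∀ c, Nonempty ({a : s // f a = c} ≃ {a : s // g a = c}) := fun c => by
    rw [← Fintype.card_eq, key, key, h]
  refine ⟨Equiv.ofFiberEquiv (f := fun a : s => f a) (g := fun a : s => g a)
    fun c => (e c).some, fun a => ?_⟩
  exact Equiv.ofFiberEquiv_map (f := fun a : s => f a) (g := fun a : s => g a) _ a

/-- The distance as a function on unordered pairs of labels. -/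
noncomputable def pairDist {m n : ℕ} (p : Config m n) : Sym2 (Fin n) → ℝ :=
  Sym2.lift ⟨fun i j => ‖p i - p j‖, fun _ _ => norm_sub_rev _ _⟩

@[simp]
theorem pairDist_mk {m n : ℕ} (p : Config m n) (i j : Fin n) :
    pairDist p s(i, j) = ‖p i - p j‖ := rfl

theorem distanceDistribution_eq_map_pairDist {m n : ℕ} (p : Config m n) :
    distanceDistribution p =
      (Finset.univ.filter (fun e : Sym2 (Fin n) => ¬ e.IsDiag)).val.map (pairDist p) := by
  have hinj : Set.InjOn (fun e : Fin n × Fin n => s(e.1, e.2))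
      (Finset.univ.filter (fun e : Fin n × Fin n => e.1 < e.2)) := by
    rintro ⟨a, b⟩ h ⟨c, d⟩ h' he
    simp at h h' he ⊢
    grind
  have him : Finset.univ.filter (fun e : Sym2 (Fin n) => ¬ e.IsDiag) =
      (Finset.univ.filter (fun e : Fin n × Fin n => e.1 < e.2)).image
        (fun e : Fin n × Fin n => s(e.1, e.2)) := by
    ext e
    induction e with | _ a b => ?_
    simp only [Finset.mem_filter, Finset.mem_univ, true_and, Sym2.mk_isDiag_iff,
      Finset.mem_image, Prod.exists, Sym2.eq_iff]
    constructor
    · intro h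
      rcases lt_or_gt_of_ne h with h | h
      · exact ⟨a, b, h, by simp⟩
      · exact ⟨b, a, h, by simp⟩
    · rintro ⟨c, d, h, h'⟩
      grind
  rw [him, Finset.image_val_of_injOn hinj, Multiset.map_map]
  rfl

/-- The matching of proper pairs is extended by the identity to diagonal pairs, where both distances
are 0. -/
theorem exists_perm_pairDist {m n : ℕ} {p q : Config m n}
    (h : distanceDistribution q = distanceDistribution p) :
    ∃ σ : Equiv.Perm (Sym2 (Fin n)), (∀ e, (σ e).IsDiag ↔ e.IsDiag) ∧
      ∀ e, pairDist p (σ e) = pairDist q e := by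
  rw [distanceDistribution_eq_map_pairDist, distanceDistribution_eq_map_pairDist] at h
  set s := Finset.univ.filter (fun e : Sym2 (Fin n) => ¬ e.IsDiag) with hs
  obtain ⟨σ, hσ⟩ := exists_perm_of_map_eq h
  have hmem : ∀ e, e ∈ s ↔ ¬ e.IsDiag := fun e => by simp [hs]
  refine ⟨Equiv.Perm.ofSubtype σ, fun e => ?_, fun e => ?_⟩
  · by_cases he : e ∈ s
    · rw [Equiv.Perm.ofSubtype_apply_of_mem σ he]
      have h1 := (hmem _).1 (σ ⟨e, he⟩).2
      have h2 := (hmem _).1 he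
      tauto
    · rw [Equiv.Perm.ofSubtype_apply_of_not_mem σ he]
  · by_cases he : e ∈ s
    · rw [Equiv.Perm.ofSubtype_apply_of_mem σ he]
      exact hσ ⟨e, he⟩
    · rw [Equiv.Perm.ofSubtype_apply_of_not_mem σ he]
      induction e with | _ a b => ?_
      have : a = b := by simpa [hmem] using he
      simp [this]

/-- A linear map whose norms agree with those of `A` factors through the range of `A`. -/
theorem exists_linearIsometryEquiv_comp {W E : Type*} [AddCommGroup W] [Module ℝ W]
    [NormedAddCommGroup E] [InnerProductSpace ℝ E] [FiniteDimensional ℝ E]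
    (A B : W →ₗ[ℝ] E) (h : ∀ w, ‖A w‖ = ‖B w‖) :
    ∃ M : E ≃ₗᵢ[ℝ] E, ∀ w, M (A w) = B w := by
  have hker : LinearMap.ker A ≤ LinearMap.ker B := fun w hw => by
    have := h w
    rw [LinearMap.mem_ker.1 hw, norm_zero] at this
    exact norm_eq_zero.1 this.symm
  let L : LinearMap.range A →ₗ[ℝ] E :=
    ((LinearMap.ker A).liftQ B hker).comp A.quotKerEquivRange.symm.toLinearMap
  have hL : ∀ w, L ⟨A w, LinearMap.mem_range_self A w⟩ = B w := fun w => by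
    have : A.quotKerEquivRange.symm ⟨A w, LinearMap.mem_range_self A w⟩ =
        (LinearMap.ker A).mkQ w := A.quotKerEquivRange_symm_apply_image w _
    simp [L, this]
  let L' : LinearMap.range A →ₗᵢ[ℝ] E := ⟨L, by
    rintro ⟨_, w, rfl⟩
    rw [hL]
    exact (h w).symm⟩
  -- An isometry defined on a subspace extends to the whole space, and in finite dimension the
  -- extension is onto.
  refine ⟨L'.extend.toLinearIsometryEquiv rfl, fun w => ?_⟩
  rw [LinearIsometry.toLinearIsometryEquiv_apply]
  exact (L'.extend_apply ⟨A w, LinearMap.mem_range_self A w⟩).trans (hL w)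

/-- Tuples with the same pairwise distances differ by a rigid motion. -/
theorem exists_rigidMotion_of_norm_sub_eq {ι E : Type*} [Fintype ι]
    [NormedAddCommGroup E] [InnerProductSpace ℝ E] [FiniteDimensional ℝ E] (p q : ι → E)
    (h : ∀ i j, ‖p i - p j‖ = ‖q i - q j‖) :
    ∃ (M : E ≃ₗᵢ[ℝ] E) (T : E), ∀ i, M (p i) + T = q i := by
  classical
  rcases isEmpty_or_nonempty ι with hι | ⟨⟨o⟩⟩
  · exact ⟨LinearIsometryEquiv.refl ℝ E, 0, fun i => isEmptyElim i⟩
  -- By polarization the Gram matrices with respect to the base point `o` agree, hence so do the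
  -- norms of all linear combinations.
  have hin : ∀ i j, inner ℝ (p i - p o) (p j - p o) = inner ℝ (q i - q o) (q j - q o) := by
    intro i j
    rw [real_inner_eq_norm_mul_self_add_norm_mul_self_sub_norm_sub_mul_self_div_two,
      real_inner_eq_norm_mul_self_add_norm_mul_self_sub_norm_sub_mul_self_div_two,
      sub_sub_sub_cancel_right, sub_sub_sub_cancel_right, h, h, h]
  obtain ⟨M, hM⟩ := exists_linearIsometryEquiv_comp
    (Fintype.linearCombination ℝ (fun i => p i - p o))
    (Fintype.linearCombination ℝ (fun i => q i - q o)) (by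
      intro w
      rw [← sq_eq_sq₀ (norm_nonneg _) (norm_nonneg _), ← real_inner_self_eq_norm_sq,
        ← real_inner_self_eq_norm_sq]
      simp only [Fintype.linearCombination_apply, sum_inner, inner_sum, inner_smul_left,
        inner_smul_right, hin])
  refine ⟨M, q o - M (p o), fun i => ?_⟩
  have := hM (Pi.single i 1)
  simp only [Fintype.linearCombination_apply_single, one_smul, map_sub] at this
  rw [← sub_eq_zero, ← sub_eq_zero.2 this]
  abel

theorem reconstructible_of_forall_exists_perm {m n : ℕ} {p : Config m n}
    (h : ∀ q : Config m n, distanceDistribution q = distanceDistribution p →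
      ∃ π : Equiv.Perm (Fin n), ∀ i j, i ≠ j → ‖p (π i) - p (π j)‖ = ‖q i - q j‖) :
    Reconstructible p := by
  intro q hq
  obtain ⟨π, hπ⟩ := h q hq
  obtain ⟨M, T, hM⟩ := exists_rigidMotion_of_norm_sub_eq p (fun i => q (π.symm i)) (by
    intro i j
    by_cases hij : i = j
    · simp [hij]
    · simpa using hπ (π.symm i) (π.symm j) (by simpa using hij))
  exact ⟨M, T, π.symm, hM⟩

/-! ### Permutations of pairs that preserve incidence -/

theorem sym2_eq_of_mem_of_ne {V : Type*} {x y : V} {e : Sym2 V} (hx : x ∈ e) (hy : y ∈ e)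
    (h : x ≠ y) : e = s(x, y) := ((Sym2.mem_and_mem_iff h).1 ⟨hx, hy⟩)

/-- A permutation of the pairs that preserves disjointness preserves incidence. -/
theorem meets_of_disjoint_mapsTo {V : Type*} [Finite V] (σ : Equiv.Perm (Sym2 V))
    (hdiag : ∀ e, (σ e).IsDiag ↔ e.IsDiag)
    (hdisj : ∀ e f : Sym2 V, ¬ e.IsDiag → ¬ f.IsDiag → (∀ x, x ∈ e → x ∉ f) →
      ∀ x, x ∈ σ e → x ∉ σ f)
    {e f : Sym2 V} (he : ¬ e.IsDiag) (hf : ¬ f.IsDiag) (hef : ∃ x, x ∈ e ∧ x ∈ f) :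
    ∃ x, x ∈ σ e ∧ x ∈ σ f := by
  by_contra! hcon
  let P : Sym2 V × Sym2 V → Prop := fun z =>
    ¬ z.1.IsDiag ∧ ¬ z.2.IsDiag ∧ ∀ x, x ∈ z.1 → x ∉ z.2
  have h1 : ∀ z, P z → P (Equiv.prodCongr σ σ z) := fun z hz =>
    ⟨by simpa [hdiag] using hz.1, by simpa [hdiag] using hz.2.1,
      by simpa using hdisj z.1 z.2 hz.1 hz.2.1 hz.2.2⟩
  -- A permutation mapping a finite set into itself maps it onto itself, so the inverse of `σ`
  -- preserves disjointness too.
  have h2 := Equiv.Perm.perm_symm_on_of_perm_on_finite (f := Equiv.prodCongr σ σ) (p := P) h1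
    (x := (σ e, σ f)) ⟨by simpa [hdiag] using he, by simpa [hdiag] using hf, hcon⟩
  obtain ⟨x, hx, hx'⟩ := hef
  exact h2.2.2 x (by simpa using hx) (by simpa using hx')

/-- An incidence preserving permutation of the pairs of labels is induced by a permutation of
the labels unless it maps a star to a triangle. -/
theorem exists_perm_of_meets {n : ℕ} (hn : 4 ≤ n) (σ : Equiv.Perm (Sym2 (Fin n)))
    (hdiag : ∀ e, (σ e).IsDiag ↔ e.IsDiag)
    (hdisj : ∀ e f : Sym2 (Fin n), ¬ e.IsDiag → ¬ f.IsDiag → (∀ x, x ∈ e → x ∉ f) →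
      ∀ x, x ∈ σ e → x ∉ σ f)
    (htri : ∀ i j k l : Fin n, [i, j, k, l].Nodup → ∀ x y z : Fin n,
      σ s(i, j) = s(x, y) → σ s(i, k) = s(x, z) → σ s(i, l) ≠ s(y, z)) :
    ∃ π : Equiv.Perm (Fin n), ∀ i j, i ≠ j → σ s(i, j) = s(π i, π j) := by
  have hmeet := fun {e f} => meets_of_disjoint_mapsTo σ hdiag hdisj (e := e) (f := f)
  have hex : ∀ T : Finset (Fin n), T.card < 4 → ∃ x, x ∉ T := by
    intro T hT
    by_contra! hcon
    have : T = Finset.univ := Finset.eq_univ_iff_forall.2 hcon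
    rw [this, Finset.card_univ, Fintype.card_fin] at hT
    omega
  -- Two image pairs at `i` are `s(x, y)` and `s(x, z)`. A third one avoiding `x` must meet both, so
  -- it is `s(y, z)`, the excluded triangle.
  have hstar : ∀ i, ∃ x, ∀ j, i ≠ j → x ∈ σ s(i, j) := by
    intro i
    obtain ⟨j, hj⟩ := hex {i} (by simp)
    obtain ⟨k, hk⟩ := hex {i, j} (lt_of_le_of_lt Finset.card_le_two (by norm_num))
    simp only [Finset.mem_singleton, Finset.mem_insert, not_or] at hj hk
    obtain ⟨x, hxj, hxk⟩ := hmeet (e := s(i, j)) (f := s(i, k)) (by simpa using Ne.symm hj)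
      (by simpa using Ne.symm hk.1) ⟨i, by simp, by simp⟩
    obtain ⟨y, hy⟩ := Sym2.mem_iff_exists.1 hxj
    obtain ⟨z, hz⟩ := Sym2.mem_iff_exists.1 hxk
    have hyz : y ≠ z := by
      rintro rfl
      have := σ.injective (hy.trans hz.symm)
      simp at this
      grind
    refine ⟨x, fun l hl => ?_⟩
    by_cases hlj : l = j
    · rw [hlj]; exact hxj
    by_cases hlk : l = k
    · rw [hlk]; exact hxk
    by_contra hx
    obtain ⟨a, ha, ha'⟩ := hmeet (e := s(i, j)) (f := s(i, l)) (by simpa using Ne.symm hj)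
      (by simpa using hl) ⟨i, by simp, by simp⟩
    obtain ⟨b, hb, hb'⟩ := hmeet (e := s(i, k)) (f := s(i, l)) (by simpa using Ne.symm hk.1)
      (by simpa using hl) ⟨i, by simp, by simp⟩
    rw [hy, Sym2.mem_iff] at ha
    rw [hz, Sym2.mem_iff] at hb
    have hay : a = y := ha.resolve_left (by rintro rfl; exact hx ha')
    have hbz : b = z := hb.resolve_left (by rintro rfl; exact hx hb')
    subst hay hbz
    refine htri i j k l ?_ x a b hy hz (sym2_eq_of_mem_of_ne ha' hb' hyz)
    simp only [List.nodup_cons, List.mem_cons, List.not_mem_nil, or_false, not_or,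
      List.nodup_nil, not_false_eq_true, and_true]
    grind
  choose π hπ using hstar
  -- If `π i = π j`, disjoint pairs `s(i, k)` and `s(j, l)` would have images sharing `π i`; four
  -- labels are needed here.
  have hinj : Function.Injective π := by
    intro i j hij
    by_contra hne
    obtain ⟨k, hk⟩ := hex {i, j} (lt_of_le_of_lt Finset.card_le_two (by norm_num))
    obtain ⟨l, hl⟩ := hex {i, j, k} (lt_of_le_of_lt Finset.card_le_three (by norm_num))
    simp only [Finset.mem_singleton, Finset.mem_insert, not_or] at hk hl
    refine hdisj s(i, k) s(j, l) (by simp; tauto) (by simp; tauto) ?_ (π i)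
      (hπ i k (by tauto)) (hij ▸ hπ j l (by tauto))
    intro x
    simp only [Sym2.mem_iff]
    grind
  refine ⟨Equiv.ofBijective π (Finite.injective_iff_bijective.1 hinj), fun i j hij => ?_⟩
  exact sym2_eq_of_mem_of_ne (hπ i j hij) (by rw [Sym2.eq_swap]; exact hπ j i hij.symm)
    (hinj.ne hij)

/-! ### The test -/

theorem g_sqDist_eq_zero {n : ℕ} (p : Config 2 n) (a b c d : Fin n) :
    g (sqDist p a b) (sqDist p a c) (sqDist p a d) (sqDist p b c) (sqDist p b d)
      (sqDist p c d) = 0 := by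
  simp only [g, sqDist, EuclideanSpace.norm_sq_eq, Fin.sum_univ_two, PiLp.sub_apply,
    Real.norm_eq_abs, sq_abs]
  ring

theorem g_comp_pairDist_eq_zero {n : ℕ} {p q : Config 2 n} {σ : Equiv.Perm (Sym2 (Fin n))}
    (h : ∀ e, pairDist p (σ e) = pairDist q e) (a b c d : Fin n) :
    g (pairDist p (σ s(a, b)) ^ 2) (pairDist p (σ s(a, c)) ^ 2) (pairDist p (σ s(a, d)) ^ 2)
      (pairDist p (σ s(b, c)) ^ 2) (pairDist p (σ s(b, d)) ^ 2)
      (pairDist p (σ s(c, d)) ^ 2) = 0 := by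
  simp only [h]
  exact g_sqDist_eq_zero q a b c d

/-- The inequalities of the test, on pairs. -/
theorem PassesTest.g_pairDist_ne_zero {n : ℕ} {p : Config 2 n} (hp : PassesTest p)
    {U V W X Y Z : Sym2 (Fin n)} (hU : ¬ U.IsDiag) (hV : ¬ V.IsDiag) (hW : ¬ W.IsDiag)
    (hX : ¬ X.IsDiag) (hY : ¬ Y.IsDiag) (hZ : ¬ Z.IsDiag) (hnd : [U, Z, V, W, X, Y].Nodup)
    {i : Fin n} (hiU : i ∈ U) (hiZ : i ∈ Z) :
    g (pairDist p U ^ 2) (pairDist p V ^ 2) (pairDist p W ^ 2) (pairDist p X ^ 2)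
      (pairDist p Y ^ 2) (pairDist p Z ^ 2) ≠ 0 := by
  obtain ⟨u, rfl⟩ := Sym2.mem_iff_exists.1 hiU
  obtain ⟨z, rfl⟩ := Sym2.mem_iff_exists.1 hiZ
  induction V with | _ v v' => ?_
  induction W with | _ w w' => ?_
  induction X with | _ x x' => ?_
  induction Y with | _ y y' => ?_
  simp only [Sym2.mk_isDiag_iff] at *
  exact hp i u z v v' w w' x x' y y' hU hZ hV hW hX hY hnd

/-- If the images of `s(a, b)` and `s(c, d)` met, they could serve as the first and last pairs of
the test, contradicting the relation among the points `a, b, c, d` of `q`. -/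
theorem PassesTest.disjoint_of_pairDist_eq {n : ℕ} {p q : Config 2 n} (hp : PassesTest p)
    {σ : Equiv.Perm (Sym2 (Fin n))} (hdiag : ∀ e, (σ e).IsDiag ↔ e.IsDiag)
    (h : ∀ e, pairDist p (σ e) = pairDist q e) (e f : Sym2 (Fin n)) (he : ¬ e.IsDiag)
    (hf : ¬ f.IsDiag) (hef : ∀ x, x ∈ e → x ∉ f) : ∀ x, x ∈ σ e → x ∉ σ f := by
  intro x hx hx'
  induction e with | _ a b => ?_
  induction f with | _ c d => ?_
  have hac : a ≠ c := by have := hef a; simp at this; tauto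
  have had : a ≠ d := by have := hef a; simp at this; tauto
  have hbc : b ≠ c := by have := hef b; simp at this; tauto
  have hbd : b ≠ d := by have := hef b; simp at this; tauto
  simp only [Sym2.mk_isDiag_iff] at he hf
  refine hp.g_pairDist_ne_zero (U := σ s(a, b)) (V := σ s(a, c)) (W := σ s(a, d))
    (X := σ s(b, c)) (Y := σ s(b, d)) (Z := σ s(c, d)) ?_ ?_ ?_ ?_ ?_ ?_ ?_ hx hx'
    (g_comp_pairDist_eq_zero h a b c d)
  any_goals simpa [hdiag]
  have : [s(a, b), s(c, d), s(a, c), s(a, d), s(b, c), s(b, d)].Nodup := by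
    simp
    grind
  exact this.map σ.injective

/-- The additional inequalities for four points: opposite sides have different lengths. -/
def OppositeSidesDiffer {n : ℕ} (p : Config 2 n) : Prop :=
  n = 4 → ∀ i j k l : Fin n, [i, j, k, l].Nodup → sqDist p i j ≠ sqDist p k l

/-- On four labels, sending a star to a triangle amounts to exchanging one pair of opposite sides.
If `g` vanishes before and after, one of these three factors is 0. -/
theorem g_swap_sub (U V W X Y Z : ℝ) :
    g U V X W Y Z - g U V W X Y Z = 2 * (U - Z) * (V - Y) * (W - X) := by
  simp only [g]; ring

theorem reconstructible_of_four_le {n : ℕ} (hn : 4 ≤ n) {p : Config 2 n} (hp : PassesTest p)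
    (hp' : OppositeSidesDiffer p) : Reconstructible p := by
  refine reconstructible_of_forall_exists_perm fun q hq => ?_
  obtain ⟨σ, hdiag, hσ⟩ := exists_perm_pairDist hq
  have hdisj := hp.disjoint_of_pairDist_eq hdiag hσ
  obtain ⟨π, hπ⟩ := exists_perm_of_meets hn σ hdiag hdisj (by
    intro i j k l hnd x y z hxy hxz hyz
    have hd : i ≠ j ∧ i ≠ k ∧ i ≠ l ∧ j ≠ k ∧ j ≠ l ∧ k ≠ l := by
      simp at hnd; tauto
    obtain ⟨hij, hik, hil, hjk, hjl, hkl⟩ := hd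
    have hnxy : x ≠ y := by simpa [hxy, hij] using hdiag s(i, j)
    have hnxz : x ≠ z := by simpa [hxz, hik] using hdiag s(i, k)
    have hnyz : y ≠ z := by simpa [hyz, hil] using hdiag s(i, l)
    rcases hn.lt_or_eq with hn5 | hn4
    -- The image of `s(i, m)` must meet all three sides of the triangle, so it contains two vertices
    -- and is itself a side, against injectivity.
    · obtain ⟨m, hm⟩ : ∃ m, m ∉ ({i, j, k, l} : Finset (Fin n)) := by
        by_contra! hcon
        have h1 : ({i, j, k, l} : Finset (Fin n)) = Finset.univ :=
          Finset.eq_univ_iff_forall.2 hcon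
        have h2 : ({i, j, k, l} : Finset (Fin n)).card ≤ 4 := Finset.card_le_four
        rw [h1, Finset.card_univ, Fintype.card_fin] at h2
        omega
      simp only [Finset.mem_insert, Finset.mem_singleton, not_or] at hm
      have him : i ≠ m := Ne.symm hm.1
      have hmeet : ∀ a, i ≠ a → ∃ v, v ∈ σ s(i, a) ∧ v ∈ σ s(i, m) := fun a ha =>
        meets_of_disjoint_mapsTo σ hdiag hdisj (by simpa using ha) (by simpa using him)
          ⟨i, by simp, by simp⟩
      obtain ⟨u, hu, hu'⟩ := hmeet j hij
      obtain ⟨v, hv, hv'⟩ := hmeet k hik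
      obtain ⟨w, hw, hw'⟩ := hmeet l hil
      have hne : ∀ a, a ≠ m → σ s(i, a) ≠ σ s(i, m) := fun a ha h => by
        have := σ.injective h
        simp at this
        grind
      have h1 := hne j (Ne.symm hm.2.1)
      have h2 := hne k (Ne.symm hm.2.2.1)
      have h3 := hne l (Ne.symm hm.2.2.2)
      rw [hxy] at hu h1
      rw [hxz] at hv h2
      rw [hyz] at hw h3
      generalize σ s(i, m) = e at *
      rw [Sym2.mem_iff] at hu hv hw
      have key : ∀ a b, a ≠ b → a ∈ e → b ∈ e → e = s(a, b) := fun a b hab ha hb =>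
        sym2_eq_of_mem_of_ne ha hb hab
      have k1 := key x y hnxy
      have k2 := key x z hnxz
      have k3 := key y z hnyz
      grind
    · subst hn4
      obtain ⟨t, ht⟩ : ∃ t, t ∉ ({x, y, z} : Finset (Fin 4)) := by
        by_contra! hcon
        have h1 : ({x, y, z} : Finset (Fin 4)) = Finset.univ :=
          Finset.eq_univ_iff_forall.2 hcon
        have h2 : ({x, y, z} : Finset (Fin 4)).card ≤ 3 := Finset.card_le_three
        rw [h1, Finset.card_univ, Fintype.card_fin] at h2
        omega
      simp only [Finset.mem_insert, Finset.mem_singleton, not_or] at ht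
      obtain ⟨htx, hty, htz⟩ := ht
      have hcompl : ∀ (f : Sym2 (Fin 4)) (a b c d : Fin 4), [a, b, c, d].Nodup →
          ¬ f.IsDiag → a ∉ f → b ∉ f → f = s(c, d) := by decide
      -- Among four labels the only pair disjoint from a given one is its complement, so the images
      -- of three sides determine the other three.
      have hopp : ∀ a b c d x y z t, σ s(a, b) = s(x, y) → [a, b, c, d].Nodup →
          [x, y, z, t].Nodup → σ s(c, d) = s(z, t) := by
        intro a b c d x y z t hx h1 h2
        have h3 : a ≠ b ∧ c ≠ d ∧ a ≠ c ∧ a ≠ d ∧ b ≠ c ∧ b ≠ d := by simp at h1; tauto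
        have h4 := hdisj s(a, b) s(c, d) (by simpa using h3.1) (by simpa using h3.2.1)
          (by intro v; simp only [Sym2.mem_iff]; grind)
        rw [hx] at h4
        exact hcompl _ x y z t h2 (by simpa [hdiag] using h3.2.1) (h4 x (by simp))
          (h4 y (by simp))
      have hkl' := hopp i j k l x y z t hxy hnd (by simp; grind)
      have hjl' := hopp i k j l x z y t hxz (by simp; grind) (by simp; grind)
      have hjk' := hopp i l j k y z x t hyz (by simp; grind) (by simp; grind)
      have h1 := g_comp_pairDist_eq_zero hσ i j k l
      rw [hxy, hxz, hyz, hkl', hjl', hjk'] at h1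
      have h2 := g_sqDist_eq_zero p x y z t
      have h3 := g_swap_sub (sqDist p x y) (sqDist p x z) (sqDist p x t) (sqDist p y z)
        (sqDist p y t) (sqDist p z t)
      rw [h2, sub_zero] at h3
      have h4 := h3.symm.trans h1
      have hs : ∀ a b c d : Fin 4, [a, b, c, d].Nodup → sqDist p a b - sqDist p c d ≠ 0 :=
        fun a b c d h => sub_ne_zero.2 (hp' rfl a b c d h)
      have e1 := hs x y z t (by simp; grind)
      have e2 := hs x z y t (by simp; grind)
      have e3 := hs x t y z (by simp; grind)
      exact mul_ne_zero (mul_ne_zero (mul_ne_zero two_ne_zero e1) e2) e3 h4)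
  refine ⟨π, fun i j hij => ?_⟩
  rw [← pairDist_mk q, ← hσ, hπ i j hij, pairDist_mk]

theorem reconstructible_of_le_three {n : ℕ} (hn : n ≤ 3) (p : Config 2 n) :
    Reconstructible p := by
  refine reconstructible_of_forall_exists_perm fun q hq => ?_
  obtain ⟨σ, hdiag, hσ⟩ := exists_perm_pairDist hq
  suffices h : ∃ π : Equiv.Perm (Fin n), ∀ i j, i ≠ j → σ s(i, j) = s(π i, π j) by
    obtain ⟨π, hπ⟩ := h
    refine ⟨π, fun i j hij => ?_⟩
    rw [← pairDist_mk q, ← hσ, hπ i j hij, pairDist_mk]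
  have hinj := σ.injective
  interval_cases n
  · exact ⟨1, fun i => i.elim0⟩
  · exact ⟨1, fun i j hij => absurd (Subsingleton.elim i j) hij⟩
  · refine ⟨1, fun i j hij => ?_⟩
    have : ∀ (e : Sym2 (Fin 2)) (i j : Fin 2), i ≠ j → ¬ e.IsDiag → e = s(i, j) := by decide
    exact this _ _ _ hij (by simpa [hdiag] using hij)
  · have h : ∀ e₀ e₁ e₂ : Sym2 (Fin 3), ¬ e₀.IsDiag → ¬ e₁.IsDiag → ¬ e₂.IsDiag →
        e₀ ≠ e₁ → e₀ ≠ e₂ → e₁ ≠ e₂ → ∃ π : Equiv.Perm (Fin 3),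
          e₀ = s(π 0, π 1) ∧ e₁ = s(π 0, π 2) ∧ e₂ = s(π 1, π 2) := by
      decide +kernel
    obtain ⟨π, h₀, h₁, h₂⟩ := h (σ s(0, 1)) (σ s(0, 2)) (σ s(1, 2)) (by simp [hdiag])
      (by simp [hdiag]) (by simp [hdiag]) (hinj.ne (by decide)) (hinj.ne (by decide))
      (hinj.ne (by decide))
    refine ⟨π, fun i j hij => ?_⟩
    have hs : ∀ a b : Fin 3, σ s(a, b) = s(π a, π b) → σ s(b, a) = s(π b, π a) := fun a b h => by
      rw [Sym2.eq_swap, h, Sym2.eq_swap]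
    fin_cases i <;> fin_cases j
    any_goals exact absurd rfl hij
    exacts [h₀, h₁, hs _ _ h₀, h₂, hs _ _ h₁, hs _ _ h₂]

theorem reconstructible_of_passesTest {n : ℕ} {p : Config 2 n} (hp : PassesTest p)
    (hp' : OppositeSidesDiffer p) : Reconstructible p := by
  rcases le_or_gt n 3 with hn | hn
  · exact reconstructible_of_le_three hn p
  · exact reconstructible_of_four_le hn hp hp'

/-! ### Openness and density -/

/-- Open and dense sets. -/
def IsOpenDense {E : Type*} [TopologicalSpace E] (S : Set E) : Prop := IsOpen S ∧ Dense S

/-- Since `ι` may be a proposition, this handles hypotheses as well as indices. -/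
theorem IsOpenDense.forall {ι : Sort*} [Finite ι] {E : Type*} [TopologicalSpace E] [BaireSpace E]
    {S : ι → E → Prop} (h : ∀ i, IsOpenDense {p | S i p}) : IsOpenDense {p | ∀ i, S i p} := by
  rw [Set.ofPred_forall]
  exact ⟨isOpen_iInter_of_finite fun i => (h i).1,
    dense_iInter_of_isOpen (fun i => (h i).1) fun i => (h i).2⟩

/-- Identity theorem: if `F` vanished near some point, it would vanish on all of the connected space
`E`. -/
theorem isOpenDense_ne_zero {E : Type*} [NormedAddCommGroup E] [NormedSpace ℝ E] {F : E → ℝ}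
    (hF : AnalyticOnNhd ℝ F Set.univ) (h : ∃ p, F p ≠ 0) : IsOpenDense {p | F p ≠ 0} := by
  refine ⟨isOpen_ne_fun (continuousOn_univ.1 hF.continuousOn) continuous_const, fun p₀ => ?_⟩
  by_contra hcon
  obtain ⟨p, hp⟩ := h
  refine hp (hF.eqOn_zero_of_preconnected_of_eventuallyEq_zero isPreconnected_univ
    (Set.mem_univ p₀) ?_ (Set.mem_univ p))
  filter_upwards [isClosed_closure.isOpen_compl.mem_nhds hcon] with x hx
  by_contra hx'
  exact hx (subset_closure hx')

theorem analyticOnNhd_sqDist {m n : ℕ} (i j : Fin n) :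
    AnalyticOnNhd ℝ (fun p : Config m n => sqDist p i j) Set.univ := by
  intro p _
  simp only [sqDist, EuclideanSpace.norm_sq_eq, PiLp.sub_apply, Real.norm_eq_abs, sq_abs]
  have h : ∀ (i : Fin n) (k : Fin m), AnalyticAt ℝ (fun p : Config m n => p i k) p := fun i k =>
    ((EuclideanSpace.proj (𝕜 := ℝ) k).comp (ContinuousLinearMap.proj (R := ℝ)
      (φ := fun _ : Fin n => EuclideanSpace ℝ (Fin m)) i)).analyticAt p
  exact Finset.analyticAt_fun_sum _ fun k _ => ((h i k).sub (h j k)).pow 2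

/-! ### Two-point configurations as witnesses for density -/

/-- The pair `e` has exactly one member in `A`. -/
def Crosses {V : Type*} (A : Set V) (e : Sym2 V) : Prop := (∃ x ∈ e, x ∈ A) ∧ ∃ x ∈ e, x ∉ A

@[simp]
theorem crosses_mk {V : Type*} (A : Set V) (i j : V) : Crosses A s(i, j) ↔ ¬ (i ∈ A ↔ j ∈ A) := by
  simp only [Crosses, Sym2.mem_iff, exists_eq_or_imp, exists_eq_left]
  tauto

/-- Adding to `A` the other end of a pair at `a` keeps that pair from crossing. If `a` lies in `R`
or `S`, one such pair is treated in each couple. Otherwise adding the other end of `P` or that of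
`Q` works: if both failed, `R` and `S` would each consist of these two ends and coincide. -/
theorem exists_cut_of_mem {V : Type*} {a : V} {P Q R S : Sym2 V} (hP : ¬ P.IsDiag)
    (hQ : ¬ Q.IsDiag) (hR : ¬ R.IsDiag) (hS : ¬ S.IsDiag) (hPQ : P ≠ Q) (hRS : R ≠ S)
    (haP : a ∈ P) (haQ : a ∈ Q) (h : ¬ (a ∈ R ∧ a ∈ S)) :
    ∃ A : Set V, a ∈ A ∧ (∀ x ∈ A, x ≠ a → s(a, x) ∈ [P, Q, R, S]) ∧
      ¬ (Crosses A P ∧ Crosses A Q) ∧ ¬ (Crosses A R ∧ Crosses A S) := by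
  obtain ⟨v, rfl⟩ := Sym2.mem_iff_exists.1 haP
  obtain ⟨y, rfl⟩ := Sym2.mem_iff_exists.1 haQ
  by_cases haR : a ∈ R
  · obtain ⟨x, rfl⟩ := Sym2.mem_iff_exists.1 haR
    exact ⟨{a, v, x}, by simp, by simp, by simp, by simp⟩
  by_cases haS : a ∈ S
  · obtain ⟨x, rfl⟩ := Sym2.mem_iff_exists.1 haS
    exact ⟨{a, v, x}, by simp, by simp, by simp, by simp⟩
  have hmem : ∀ u e, a ∉ e → Crosses {a, u} e → u ∈ e := by
    rintro u e hae ⟨⟨x, hx, hx'⟩, -⟩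
    rcases hx' with rfl | rfl
    · exact absurd hx hae
    · exact hx
  by_cases hv : Crosses {a, v} R ∧ Crosses {a, v} S
  · refine ⟨{a, y}, by simp, by simp, by simp, fun hy => hRS ?_⟩
    have hvy : v ≠ y := by rintro rfl; exact hPQ rfl
    rw [sym2_eq_of_mem_of_ne (hmem v R haR hv.1) (hmem y R haR hy.1) hvy,
      sym2_eq_of_mem_of_ne (hmem v S haS hv.2) (hmem y S haS hy.2) hvy]
  · exact ⟨{a, v}, by simp, by simp, by simp, hv⟩

/-- The set `{a}` works unless exactly one of the couples `P, Q` and `R, S` lies entirely at `a`. In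
that case `A` is enlarged only along these four pairs, so `b` and `c` stay outside. -/
theorem exists_cut {V : Type*} {a b c : V} {P Q R S : Sym2 V} (hab : a ≠ b) (hac : a ≠ c)
    (hP : ¬ P.IsDiag) (hQ : ¬ Q.IsDiag) (hR : ¬ R.IsDiag) (hS : ¬ S.IsDiag)
    (hnd : [s(a, b), s(a, c), P, Q, R, S].Nodup) :
    ∃ A : Set V, Crosses A s(a, b) ∧ Crosses A s(a, c) ∧
      (Crosses A P ∧ Crosses A Q ↔ Crosses A R ∧ Crosses A S) := by
  simp only [List.nodup_cons, List.mem_cons, List.not_mem_nil, or_false, not_or,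
      List.nodup_nil, not_false_eq_true, and_true] at hnd
  have hfar : ∀ (A : Set V), a ∈ A → (∀ x ∈ A, x ≠ a → s(a, x) ∈ [P, Q, R, S]) →
      Crosses A s(a, b) ∧ Crosses A s(a, c) := by
    intro A ha hA
    have h1 := fun h => hA b h hab.symm
    have h2 := fun h => hA c h hac.symm
    simp only [List.mem_cons, List.not_mem_nil, or_false] at h1 h2
    simp only [crosses_mk]
    tauto
  have hsing : ∀ e : Sym2 V, ¬ e.IsDiag → (Crosses {a} e ↔ a ∈ e) := by
    intro e he
    induction e with | _ x y => ?_
    simp only [crosses_mk, Set.mem_singleton_iff, Sym2.mem_iff]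
    rw [Sym2.mk_isDiag_iff] at he
    grind
  by_cases h1 : a ∈ P ∧ a ∈ Q <;> by_cases h2 : a ∈ R ∧ a ∈ S
  · obtain ⟨h3, h4⟩ := hfar {a} rfl (fun x hx hx' => absurd hx hx')
    exact ⟨{a}, h3, h4, by rw [hsing P hP, hsing Q hQ, hsing R hR, hsing S hS]; exact iff_of_true h1 h2⟩
  · obtain ⟨A, ha, hA, h3, h4⟩ :=
      exists_cut_of_mem hP hQ hR hS hnd.2.2.1.1 hnd.2.2.2.2 h1.1 h1.2 h2
    exact ⟨A, (hfar A ha hA).1, (hfar A ha hA).2, iff_of_false h3 h4⟩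
  · obtain ⟨A, ha, hA, h3, h4⟩ :=
      exists_cut_of_mem hR hS hP hQ hnd.2.2.2.2 hnd.2.2.1.1 h2.1 h2.2 h1
    have hA' : ∀ x ∈ A, x ≠ a → s(a, x) ∈ [P, Q, R, S] := fun x hx hx' => by
      have := hA x hx hx'
      simp only [List.mem_cons, List.not_mem_nil, or_false] at this ⊢
      rcases this with h | h | h | h <;> simp [h]
    exact ⟨A, (hfar A ha hA').1, (hfar A ha hA').2, iff_of_false h4 h3⟩
  · obtain ⟨h3, h4⟩ := hfar {a} rfl (fun x hx hx' => absurd hx hx')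
    exact ⟨{a}, h3, h4, by rw [hsing P hP, hsing Q hQ, hsing R hR, hsing S hS]; exact iff_of_false h1 h2⟩

open Classical in
/-- The configuration with the labels from `A` at one point and all others at another one. -/
noncomputable def cutConfig {n : ℕ} (A : Set (Fin n)) : Config 2 n :=
  fun i => if i ∈ A then !₂[1, 0] else 0

open Classical in
theorem sqDist_cutConfig {n : ℕ} (A : Set (Fin n)) (i j : Fin n) :
    sqDist (cutConfig A) i j = if Crosses A s(i, j) then 1 else 0 := by
  simp only [sqDist, cutConfig, EuclideanSpace.norm_sq_eq, Fin.sum_univ_two, PiLp.sub_apply,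
    Real.norm_eq_abs, sq_abs, crosses_mk]
  by_cases hi : i ∈ A <;> by_cases hj : j ∈ A <;> simp [hi, hj]

open Classical in
-- The hypothesis is sharp: if exactly one of `v ∧ y` and `x ∧ w` holds, the value is 0.
theorem g_indicator_ne_zero {v w x y : Prop} (h : v ∧ y ↔ x ∧ w) :
    g 1 (if v then 1 else 0) (if w then 1 else 0) (if x then 1 else 0) (if y then 1 else 0) 1 ≠
      0 := by
  by_cases hv : v <;> by_cases hw : w <;> by_cases hx : x <;> by_cases hy : y <;>
    simp only [hv, hw, hx, hy, and_true, false_iff, and_false,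
      iff_false, not_true_eq_false] at h <;>
    simp only [hv, hw, hx, hy, if_true, if_false, g] <;> norm_num

theorem isOpenDense_passesTest (n : ℕ) : IsOpenDense {p : Config 2 n | PassesTest p} := by
  unfold PassesTest
  refine .forall fun i₀ => .forall fun i₁ => .forall fun i₂ => .forall fun j₁ => .forall fun j₂ =>
    .forall fun k₁ => .forall fun k₂ => .forall fun l₁ => .forall fun l₂ => .forall fun m₁ =>
    .forall fun m₂ => .forall fun hi₁ => .forall fun hi₂ => .forall fun hj => .forall fun hk =>
    .forall fun hl => .forall fun hm => .forall fun hnd => isOpenDense_ne_zero ?_ ?_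
  · have h := fun i j : Fin n => analyticOnNhd_sqDist (m := 2) i j
    intro p hp
    have h' := fun i j : Fin n => h i j p hp
    unfold g
    fun_prop
  -- The reordering puts the arguments `V, Y` of `g` side by side, and likewise `X, W`: these are
  -- its opposite sides.
  · have hnd' : [s(i₀, i₁), s(i₀, i₂), s(j₁, j₂), s(m₁, m₂), s(l₁, l₂), s(k₁, k₂)].Nodup := by
      refine hnd.perm ?_
      refine .cons _ (.cons _ (.cons _ ?_))
      exact List.reverse_perm [s(m₁, m₂), s(l₁, l₂), s(k₁, k₂)]
    obtain ⟨A, h₁, h₂, h⟩ := exists_cut hi₁ hi₂ (by simpa using hj) (by simpa using hm)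
      (by simpa using hl) (by simpa using hk) hnd'
    refine ⟨cutConfig A, ?_⟩
    simp only [sqDist_cutConfig]
    rw [if_pos h₁, if_pos h₂]
    exact g_indicator_ne_zero h

theorem isOpenDense_oppositeSidesDiffer (n : ℕ) :
    IsOpenDense {p : Config 2 n | OppositeSidesDiffer p} := by
  unfold OppositeSidesDiffer
  refine .forall fun _ => .forall fun i => .forall fun j => .forall fun k => .forall fun l =>
    .forall fun hnd => ?_
  simp only [← sub_ne_zero (a := sqDist _ _ _)]
  -- With `i` alone at one point, the side from `i` to `j` has length 1 and the opposite side length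
  -- 0.
  refine isOpenDense_ne_zero ((analyticOnNhd_sqDist i j).sub (analyticOnNhd_sqDist k l))
    ⟨cutConfig {i}, ?_⟩
  have h : i ≠ j ∧ i ≠ k ∧ i ≠ l := by simp at hnd; tauto
  simp [sqDist_cutConfig, h.1.symm, h.2.1.symm, h.2.2.symm]

theorem isOpenDense_and (n : ℕ) :
    IsOpenDense {p : Config 2 n | PassesTest p ∧ OppositeSidesDiffer p} := by
  have h₁ := isOpenDense_passesTest n
  have h₂ := isOpenDense_oppositeSidesDiffer n
  exact ⟨h₁.1.inter h₂.1, h₁.2.inter_of_isOpen_left h₂.2 h₁.1⟩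

/-! ### Programs -/

/-- A straight line program. -/
def block : List Instr → Prog
  | [] => .skip
  | i :: l => .seq (.instr i) (block l)

/-- The effect of a straight line program. -/
def runList (l : List Instr) (s : State) : State := l.foldl (fun s i => i.run s) s

@[simp]
theorem runList_append (l l' : List Instr) (s : State) :
    runList (l ++ l') s = runList l' (runList l s) := List.foldl_append

@[simp]
theorem runList_nil (s : State) : runList [] s = s := rfl

@[simp]
theorem runList_cons (i : Instr) (l : List Instr) (s : State) :
    runList (i :: l) s = runList l (i.run s) := rfl

theorem exec_block (l : List Instr) (s : State) :
    Exec (block l) s (l.length + 1) (runList l s) := by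
  induction l generalizing s with
  | nil => exact .skip s
  | cons i l ih =>
    have := Exec.seq (.instr i s) (ih (i.run s))
    rwa [show 1 + (l.length + 1) = (i :: l).length + 1 by simp; omega] at this

/-! ### Specification of programs by a failure flag -/

/-- The property `P` of the index registers depends on the registers below `k` only. -/
def DependsBelow (k : ℕ) (P : (ℕ → ℕ) → Prop) : Prop :=
  ∀ ρ ρ' : ℕ → ℕ, (∀ j < k, ρ j = ρ' j) → (P ρ ↔ P ρ')

/-- On memory `m`, with `n` in register `0` and `1` in register `1`, the program `B` takes at most
`T` steps, keeps the memory and the registers below `k`, and register `f` is zero afterwards if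
and only if it was zero before and the registers do not satisfy `P`. -/
def Raises (n : ℕ) (m : ℕ → ℝ) (f k T : ℕ) (B : Prog) (P : (ℕ → ℕ) → Prop) : Prop :=
  ∀ s : State, s.reg 0 = n → s.reg 1 = 1 → s.mem = m → ∃ (t : ℕ) (s' : State),
    Exec B s t s' ∧ t ≤ T ∧ s'.mem = m ∧ (∀ j < k, s'.reg j = s.reg j) ∧
      (s'.reg f = 0 ↔ s.reg f = 0 ∧ ¬ P s.reg)

section Raises

variable {n : ℕ} {m : ℕ → ℝ} {f k T T' : ℕ} {A B : Prog} {P Q : (ℕ → ℕ) → Prop}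

theorem Raises.congr (h : Raises n m f k T A P) (hPQ : ∀ ρ, P ρ ↔ Q ρ) :
    Raises n m f k T A Q := by
  rwa [show Q = P from funext fun ρ => propext (hPQ ρ).symm]

theorem Raises.mono (h : Raises n m f k T A P) (hT : T ≤ T') : Raises n m f k T' A P := by
  intro s h₀ h₁ hm
  obtain ⟨t, s', he, ht, h'⟩ := h s h₀ h₁ hm
  exact ⟨t, s', he, ht.trans hT, h'⟩

theorem Raises.skip : Raises n m f k 1 .skip fun _ => False :=
  fun s _ _ hm => ⟨1, s, .skip s, le_rfl, hm, fun _ _ => rfl, by simp⟩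

theorem Raises.raise (hk : k ≤ f) : Raises n m f k 1 (.instr (.regConst f 1)) fun _ => True := by
  refine fun s _ _ hm => ⟨1, _, .instr _ s, le_rfl, hm, fun j hj => ?_, ?_⟩
  · simp [Instr.run, (hj.trans_le hk).ne]
  · simp [Instr.run]

theorem Raises.seq (hA : Raises n m f k T A P) (hB : Raises n m f k T' B Q)
    (hQ : DependsBelow k Q) (hk : 1 < k) :
    Raises n m f k (T + T') (.seq A B) fun ρ => P ρ ∨ Q ρ := by
  intro s h₀ h₁ hm
  obtain ⟨t, s', he, ht, hm', hr, hf⟩ := hA s h₀ h₁ hm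
  obtain ⟨t', s'', he', ht', hm'', hr', hf'⟩ :=
    hB s' ((hr 0 (by omega)).trans h₀) ((hr 1 hk).trans h₁) hm'
  refine ⟨t + t', s'', he.seq he', by omega, hm'', fun j hj => (hr' j hj).trans (hr j hj), ?_⟩
  rw [hf', hf, hQ _ _ hr]
  tauto

theorem Raises.ifRegEq (hA : Raises n m f k T A P) (x y : ℕ) :
    Raises n m f k (T + 2) (.branch (.regEq x y) A .skip) fun ρ => ρ x = ρ y ∧ P ρ := by
  intro s h₀ h₁ hm
  by_cases h : s.reg x = s.reg y
  · obtain ⟨t, s', he, ht, hm', hr, hf⟩ := hA s h₀ h₁ hm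
    exact ⟨1 + t, s', .branchTrue h he, by omega, hm', hr, by rw [hf]; tauto⟩
  · exact ⟨1 + 1, s, .branchFalse h (.skip s), by omega, hm, fun _ _ => rfl, by tauto⟩

/-! #### Loops -/

/-- `for x = 0, …, n - 1 do B`, where `n` is in register `0` and `1` in register `1`. -/
def forLoop (x : ℕ) (B : Prog) : Prog :=
  .seq (.instr (.regConst x 0))
    (.loop (.regLt x 0) (.seq B (.instr (.regAdd x x 1))))

/-- Here `d` is the number of remaining passes. The body keeps the counter and all lower registers,
on which alone `P` depends, so each pass settles exactly one value of the counter. -/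
theorem Raises.exec_loop (hB : Raises n m f (k + 1) T B P) (hP : DependsBelow (k + 1) P)
    (hk : 1 < k) (hf : k < f) (d : ℕ) (s : State) (h₀ : s.reg 0 = n) (h₁ : s.reg 1 = 1)
    (hm : s.mem = m) (hd : s.reg k + d = n) : ∃ (t : ℕ) (s' : State),
      Exec (.loop (.regLt k 0) (.seq B (.instr (.regAdd k k 1)))) s t s' ∧
      t ≤ d * (T + 2) + 1 ∧ s'.mem = m ∧ (∀ j < k, s'.reg j = s.reg j) ∧
      (s'.reg f = 0 ↔ s.reg f = 0 ∧
        ∀ x, s.reg k ≤ x → x < n → ¬ P (Function.update s.reg k x)) := by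
  induction d generalizing s with
  | zero =>
    refine ⟨1, s, .loopDone ?_, by omega, hm, fun _ _ => rfl, ?_⟩
    · simp only [Test.Holds]; omega
    · exact ⟨fun h => ⟨h, fun x h h' => by omega⟩, fun h => h.1⟩
  | succ d ih =>
    obtain ⟨t, s₁, he, ht, hm₁, hr₁, hf₁⟩ := hB s h₀ h₁ hm
    let s₂ := (Instr.regAdd k k 1).run s₁
    have hk₂ : s₂.reg k = s.reg k + 1 := by
      simp [s₂, Instr.run, hr₁ k (by omega), hr₁ 1 (by omega), h₁]
    have hr₂ : ∀ j ≠ k, s₂.reg j = s₁.reg j := fun j hj => by simp [s₂, Instr.run, hj]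
    have hr : ∀ j < k, s₂.reg j = s.reg j := fun j hj =>
      (hr₂ j hj.ne).trans (hr₁ j (by omega))
    obtain ⟨t', s', he', ht', hm', hr', hf'⟩ := ih s₂ ((hr 0 (by omega)).trans h₀)
      ((hr 1 hk).trans h₁) hm₁ (by omega)
    refine ⟨1 + (t + 1) + t', s', .loopStep ?_ (he.seq (.instr _ s₁)) he', ?_, hm',
      fun j hj => (hr' j hj).trans (hr j hj), ?_⟩
    · simp only [Test.Holds]; omega
    · rw [Nat.succ_mul]; omega
    · have hupd : ∀ x, P (Function.update s₂.reg k x) ↔ P (Function.update s.reg k x) := by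
        refine fun x => hP _ _ fun j hj => ?_
        rcases (Nat.lt_succ_iff_lt_or_eq.1 hj) with hj | rfl
        · simp [hj.ne, hr j hj]
        · simp
      rw [hf', hr₂ f hf.ne', hf₁, hk₂]
      simp only [hupd]
      constructor
      · rintro ⟨⟨h, hp⟩, h'⟩
        refine ⟨h, fun x hx hxn => ?_⟩
        rcases hx.eq_or_lt with rfl | hx
        · rwa [Function.update_eq_self]
        · exact h' x hx hxn
      · rintro ⟨h, h'⟩
        have := h' (s.reg k) le_rfl (by omega)
        rw [Function.update_eq_self] at this
        exact ⟨⟨h, this⟩, fun x hx => h' x (by omega)⟩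

theorem Raises.forLoop (hB : Raises n m f (k + 1) T B P) (hP : DependsBelow (k + 1) P)
    (hk : 1 < k) (hf : k < f) : Raises n m f k (n * (T + 2) + 2) (forLoop k B)
      fun ρ => ∃ x < n, P (Function.update ρ k x) := by
  intro s h₀ h₁ hm
  have hr : ∀ j ≠ k, ((Instr.regConst k 0).run s).reg j = s.reg j := fun j hj => by
    simp [Instr.run, hj]
  have hk0 : ((Instr.regConst k 0).run s).reg k = 0 := by simp [Instr.run]
  obtain ⟨t, s', he, ht, hm', hr', hf'⟩ := hB.exec_loop hP hk hf n ((Instr.regConst k 0).run s)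
    ((hr 0 (by omega)).trans h₀) ((hr 1 hk.ne).trans h₁) hm (by omega)
  refine ⟨1 + t, s', .seq (.instr _ s) he, by omega, hm',
    fun j hj => (hr' j hj).trans (hr j hj.ne), ?_⟩
  rw [hf', hr f hf.ne', hk0]
  simp [Instr.run]

/-- Nested loops over the registers `k, …, k + d - 1`. -/
def nest : ℕ → ℕ → Prog → Prog
  | _, 0, B => B
  | k, d + 1, B => DistRec.forLoop k (nest (k + 1) d B)

/-- Some choice of values below `n` for the registers `k, …, k + d - 1` satisfies `P`. -/
def SomeBelow (n k d : ℕ) (P : (ℕ → ℕ) → Prop) (ρ : ℕ → ℕ) : Prop :=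
  ∃ ρ' : ℕ → ℕ, (∀ j < k, ρ' j = ρ j) ∧ (∀ j, k ≤ j → j < k + d → ρ' j < n) ∧ P ρ'

theorem dependsBelow_someBelow (d : ℕ) : DependsBelow k (SomeBelow n k d P) := by
  intro ρ ρ' h
  have (σ : ℕ → ℕ) : (∀ j < k, σ j = ρ j) ↔ ∀ j < k, σ j = ρ' j :=
    forall₂_congr fun j hj => by rw [h j hj]
  simp only [SomeBelow, this]

theorem someBelow_succ (d : ℕ) (ρ : ℕ → ℕ) :
    (∃ x < n, SomeBelow n (k + 1) d P (Function.update ρ k x)) ↔ SomeBelow n k (d + 1) P ρ := by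
  constructor
  · rintro ⟨x, hx, ρ', h₁, h₂, h₃⟩
    refine ⟨ρ', fun j hj => ?_, fun j hj hj' => ?_, h₃⟩
    · simpa [hj.ne] using h₁ j (by omega)
    · rcases hj.eq_or_lt with rfl | hj
      · simpa [h₁ k (by omega)] using hx
      · exact h₂ j hj (by omega)
  · rintro ⟨ρ', h₁, h₂, h₃⟩
    refine ⟨ρ' k, h₂ k le_rfl (by omega), ρ', fun j hj => ?_,
      fun j hj hj' => h₂ j (by omega) (by omega), h₃⟩
    rcases (Nat.lt_succ_iff_lt_or_eq.1 hj) with hj | rfl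
    · simp [hj.ne, h₁ j hj]
    · simp

theorem Raises.nest (hn : 1 ≤ n) (d : ℕ) (hB : Raises n m f (k + d) T B P)
    (hP : DependsBelow (k + d) P) (hk : 1 < k) (hf : k + d ≤ f) :
    Raises n m f k ((T + 4 * d) * n ^ d) (nest k d B) (SomeBelow n k d P) := by
  induction d generalizing k with
  | zero =>
    refine (hB.mono (by simp)).congr fun ρ => ⟨fun h => ⟨ρ, by simp, fun j _ _ => by omega, h⟩, ?_⟩
    rintro ⟨ρ', h₁, -, h₂⟩
    exact (hP _ _ h₁).1 h₂
  | succ d ih =>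
    rw [show k + (d + 1) = k + 1 + d by omega] at hB hP hf
    refine (((ih hB hP (by omega) hf).forLoop (dependsBelow_someBelow d) hk (by omega)).mono
      ?_).congr (someBelow_succ d)
    have h₁ : 1 ≤ n ^ d := Nat.one_le_pow _ _ hn
    -- A loop has overhead `2 * n + 2`, which is at most `4 * n ^ (d + 1)` as `n ≥ 1`; hence the 4
    -- per level.
    have h₂ : n ≤ n ^ (d + 1) := by rw [pow_succ]; nlinarith
    calc n * ((T + 4 * d) * n ^ d + 2) + 2 = (T + 4 * d) * n ^ (d + 1) + (2 * n + 2) := by ring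
      _ ≤ (T + 4 * d) * n ^ (d + 1) + 4 * n ^ (d + 1) := by omega
      _ = (T + 4 * (d + 1)) * n ^ (d + 1) := by ring

/-! #### Comparison of pairs -/

/-- Raise register `f` if the pairs in the registers `q₁, q₂` and `q₃, q₄` are equal. -/
def pairTest (f : ℕ) (q : ℕ × ℕ × ℕ × ℕ) : Prog :=
  .seq
    (.branch (.regEq q.1 q.2.2.1)
      (.branch (.regEq q.2.1 q.2.2.2) (.instr (.regConst f 1)) .skip) .skip)
    (.branch (.regEq q.1 q.2.2.2)
      (.branch (.regEq q.2.1 q.2.2.1) (.instr (.regConst f 1)) .skip) .skip)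

/-- The pairs in the registers `q₁, q₂` and `q₃, q₄` are equal. -/
def PairEq (ρ : ℕ → ℕ) (q : ℕ × ℕ × ℕ × ℕ) : Prop :=
  s(ρ q.1, ρ q.2.1) = s(ρ q.2.2.1, ρ q.2.2.2)

/-- All registers named by `q` are below `k`. -/
def QuadBelow (k : ℕ) (q : ℕ × ℕ × ℕ × ℕ) : Prop :=
  q.1 < k ∧ q.2.1 < k ∧ q.2.2.1 < k ∧ q.2.2.2 < k

theorem dependsBelow_pairEq {q : ℕ × ℕ × ℕ × ℕ} (hq : QuadBelow k q) :
    DependsBelow k fun ρ => PairEq ρ q := by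
  intro ρ ρ' h
  simp only [PairEq, h _ hq.1, h _ hq.2.1, h _ hq.2.2.1, h _ hq.2.2.2]

theorem Raises.pairTest {q : ℕ × ℕ × ℕ × ℕ} (hq : QuadBelow k q) (hk : 1 < k) (hf : k ≤ f) :
    Raises n m f k 10 (pairTest f q) fun ρ => PairEq ρ q := by
  refine ((((Raises.raise hf).ifRegEq _ _).ifRegEq _ _).seq
    (((Raises.raise hf).ifRegEq _ _).ifRegEq _ _) ?_ hk).congr fun ρ => ?_
  · intro ρ ρ' h
    simp only [h _ hq.1, h _ hq.2.1, h _ hq.2.2.1, h _ hq.2.2.2]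
  · simp [PairEq]

/-- Raise register `f` if one of the pairs of pairs in `G` consists of equal pairs. -/
def pairTests (f : ℕ) : List (ℕ × ℕ × ℕ × ℕ) → Prog
  | [] => .skip
  | q :: G => .seq (pairTest f q) (pairTests f G)

theorem dependsBelow_exists_pairEq {G : List (ℕ × ℕ × ℕ × ℕ)} (hG : ∀ q ∈ G, QuadBelow k q) :
    DependsBelow k fun ρ => ∃ q ∈ G, PairEq ρ q := by
  intro ρ ρ' h
  exact exists_congr fun q => and_congr_right fun hq => dependsBelow_pairEq (hG q hq) ρ ρ' h

theorem Raises.pairTests {G : List (ℕ × ℕ × ℕ × ℕ)} (hG : ∀ q ∈ G, QuadBelow k q) (hk : 1 < k)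
    (hf : k ≤ f) :
    Raises n m f k (10 * G.length + 1) (pairTests f G) fun ρ => ∃ q ∈ G, PairEq ρ q := by
  induction G with
  | nil => exact Raises.skip.congr fun ρ => by simp
  | cons q G ih =>
    have hG' : ∀ q ∈ G, QuadBelow k q := fun q hq => hG q (by simp [hq])
    refine (((Raises.pairTest (hG q (by simp)) hk hf).seq (ih hG')
      (dependsBelow_exists_pairEq hG') hk).mono ?_).congr fun ρ => by simp
    simp only [List.length_cons]
    omega

/-- Run `A` unless one of the pairs of pairs in `G` consists of equal pairs. -/
def unlessEq (G : List (ℕ × ℕ × ℕ × ℕ)) (A : Prog) : Prog :=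
  .seq (block [.regConst 14 0, .regConst 15 0])
    (.seq (pairTests 15 G) (.branch (.regEq 15 14) A .skip))

theorem Raises.unlessEq {G : List (ℕ × ℕ × ℕ × ℕ)} (hG : ∀ q ∈ G, QuadBelow 13 q)
    (hA : Raises n m 13 13 T A P) (hP : DependsBelow 13 P) :
    Raises n m 13 13 (T + 10 * G.length + 6) (unlessEq G A)
      fun ρ => (∀ q ∈ G, ¬ PairEq ρ q) ∧ P ρ := by
  intro s h₀ h₁ hm
  let s₁ := runList [.regConst 14 0, .regConst 15 0] s
  have hr₁ : ∀ j < 14, s₁.reg j = s.reg j := fun j hj => by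
    simp [s₁, Instr.run, show j ≠ 14 by omega, show j ≠ 15 by omega]
  have h14 : s₁.reg 14 = 0 := by simp [s₁, Instr.run]
  have h15 : s₁.reg 15 = 0 := by simp [s₁, Instr.run]
  -- With bound 15 the comparisons preserve the outer flag in register 13 and the zero in register
  -- 14.
  have hG15 : ∀ q ∈ G, QuadBelow 15 q := fun q hq => by
    obtain ⟨h₁, h₂, h₃, h₄⟩ := hG q hq
    exact ⟨by omega, by omega, by omega, by omega⟩
  obtain ⟨t₂, s₂, he₂, ht₂, hm₂, hr₂, hf₂⟩ := Raises.pairTests (n := n) (m := m) (f := 15) hG15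
    (by norm_num) le_rfl s₁ ((hr₁ 0 (by norm_num)).trans h₀) ((hr₁ 1 (by norm_num)).trans h₁) hm
  have hr : ∀ j < 14, s₂.reg j = s.reg j := fun j hj =>
    (hr₂ j (by omega)).trans (hr₁ j hj)
  have hiff : s₂.reg 15 = 0 ↔ ∀ q ∈ G, ¬ PairEq s.reg q := by
    rw [hf₂, dependsBelow_exists_pairEq hG s₁.reg s.reg fun j hj => hr₁ j (by omega)]
    simp [h15]
  obtain ⟨t₃, s₃, he₃, ht₃, hm₃, hr₃, hf₃⟩ := (hA.ifRegEq 15 14) s₂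
    ((hr 0 (by norm_num)).trans h₀) ((hr 1 (by norm_num)).trans h₁) hm₂
  refine ⟨_, s₃, (exec_block _ s).seq (he₂.seq he₃), ?_, hm₃,
    fun j hj => (hr₃ j hj).trans (hr j (by omega)), ?_⟩
  · simp only [List.length_cons, List.length_nil]
    omega
  · rw [hf₃]
    beta_reduce
    rw [hr 13 (by norm_num), hr₂ 14 (by norm_num), h14, hiff,
      hP s₂.reg s.reg fun j hj => hr j (by omega)]

/-- Run `A` if register `0` holds `c`. -/
def whenConst (c : ℕ) (A : Prog) : Prog :=
  .seq (.instr (.regConst 14 c)) (.branch (.regEq 0 14) A .skip)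

theorem Raises.whenConst (hA : Raises n m 13 13 T A P) (hP : DependsBelow 13 P) (c : ℕ) :
    Raises n m 13 13 (T + 3) (whenConst c A) fun ρ => ρ 0 = c ∧ P ρ := by
  intro s h₀ h₁ hm
  have hr : ∀ j ≠ 14, ((Instr.regConst 14 c).run s).reg j = s.reg j := fun j hj => by
    simp [Instr.run, hj]
  have h14 : ((Instr.regConst 14 c).run s).reg 14 = c := by simp [Instr.run]
  obtain ⟨t, s', he, ht, hm', hr', hf⟩ := (hA.ifRegEq 0 14) ((Instr.regConst 14 c).run s)
    ((hr 0 (by norm_num)).trans h₀) ((hr 1 (by norm_num)).trans h₁) hm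
  refine ⟨1 + t, s', .seq (.instr _ s) he, by omega, hm',
    fun j hj => (hr' j hj).trans (hr j (by omega)), ?_⟩
  rw [hf]
  beta_reduce
  rw [hr 13 (by norm_num), hr 0 (by norm_num), h14,
    hP _ s.reg fun j hj => hr j (by omega)]

/-! #### Arithmetic -/

/-- The code `l` raises register `13` if `val a = val b` after it. -/
def valTest (l : List Instr) (a b : ℕ) : Prog :=
  .seq (block l) (.branch (.valEq a b) (.instr (.regConst 13 1)) .skip)

theorem Raises.valTest {l : List Instr} {a b : ℕ}
    (hl : ∀ s : State, s.reg 1 = 1 → s.mem = m → (runList l s).mem = m ∧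
      (∀ j < 14, (runList l s).reg j = s.reg j) ∧
      ((runList l s).val a = (runList l s).val b ↔ P s.reg)) :
    Raises n m 13 13 (l.length + 3) (valTest l a b) P := by
  intro s h₀ h₁ hm
  obtain ⟨hm', hr, hv⟩ := hl s h₁ hm
  by_cases h : P s.reg
  · refine ⟨_, _, (exec_block l s).seq (.branchTrue (hv.2 h) (.instr _ _)), by omega, hm',
      fun j hj => ?_, ?_⟩
    · simp [Instr.run, hj.ne, hr j (by omega)]
    · simp [Instr.run, h]
  · refine ⟨_, _, (exec_block l s).seq (.branchFalse (fun h' => h (hv.1 h')) (.skip _)), by omega,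
      hm', fun j hj => hr j (by omega), ?_⟩
    rw [hr 13 (by norm_num)]
    tauto

/-- The squared distance of the points number `i` and `j` in memory. -/
def memSqDist (m : ℕ → ℝ) (i j : ℕ) : ℝ :=
  (m (i + i) - m (j + j)) ^ 2 + (m (i + i + 1) - m (j + j + 1)) ^ 2

/-- The squared distance of the points whose numbers are in the registers `x` and `y`. -/
def distCode (a x y : ℕ) : List Instr :=
  [.regAdd 14 x x, .load a 14, .regAdd 14 14 1, .load (a + 1) 14,
    .regAdd 14 y y, .load (a + 2) 14, .regAdd 14 14 1, .load (a + 3) 14,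
    .valSub a a (a + 2), .valMul a a a, .valSub (a + 1) (a + 1) (a + 3),
    .valMul (a + 1) (a + 1) (a + 1), .valAdd a a (a + 1)]

/-- Only `y` needs a bound: `x` is read before register 14 is overwritten. -/
theorem runList_distCode {a x y : ℕ} (hy : y < 14) {s : State} (h₁ : s.reg 1 = 1) :
    (runList (distCode a x y) s).mem = s.mem ∧
    (∀ j < 14, (runList (distCode a x y) s).reg j = s.reg j) ∧
    (∀ j < a, (runList (distCode a x y) s).val j = s.val j) ∧
    (runList (distCode a x y) s).val a = memSqDist s.mem (s.reg x) (s.reg y) := by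
  refine ⟨rfl, fun j hj => ?_, fun j hj => ?_, ?_⟩
  · simp [distCode, Instr.run, hj.ne]
  · simp [distCode, Instr.run, hj.ne, show j ≠ a + 1 by omega, show j ≠ a + 2 by omega,
      show j ≠ a + 3 by omega]
  · simp [distCode, Instr.run, hy.ne, h₁, memSqDist, sq]

/-- Squared distances, in consecutive registers. -/
def distsCode : ℕ → List (ℕ × ℕ) → List Instr
  | _, [] => []
  | a, z :: L => distCode a z.1 z.2 ++ distsCode (a + 1) L

/-- A distance uses the three registers after its own as scratch space; later results may overwrite
those, and finished results lie below. -/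
theorem runList_distsCode (L : List (ℕ × ℕ)) (hL : ∀ z ∈ L, z.1 < 14 ∧ z.2 < 14) (a : ℕ)
    {s : State} (h₁ : s.reg 1 = 1) :
    (runList (distsCode a L) s).mem = s.mem ∧
    (∀ j < 14, (runList (distsCode a L) s).reg j = s.reg j) ∧
    (∀ j < a, (runList (distsCode a L) s).val j = s.val j) ∧
    ∀ (i : ℕ) (hi : i < L.length), (runList (distsCode a L) s).val (a + i) =
      memSqDist s.mem (s.reg L[i].1) (s.reg L[i].2) := by
  induction L generalizing a s with
  | nil => exact ⟨rfl, fun _ _ => rfl, fun _ _ => rfl, fun i hi => absurd hi (by simp)⟩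
  | cons z L ih =>
    obtain ⟨hm, hr, hv, hd⟩ := runList_distCode (a := a) (x := z.1) (hL z (by simp)).2 h₁
    obtain ⟨hm', hr', hv', hd'⟩ := ih (fun z hz => hL z (by simp [hz])) (a + 1)
      (s := runList (distCode a z.1 z.2) s) ((hr 1 (by norm_num)).trans h₁)
    simp only [distsCode, runList_append]
    refine ⟨hm'.trans hm, fun j hj => (hr' j hj).trans (hr j hj),
      fun j hj => (hv' j (by omega)).trans (hv j hj), fun i hi => ?_⟩
    cases i with
    | zero => exact (hv' a (by omega)).trans hd
    | succ i =>
      have hi' : i < L.length := by simpa using hi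
      have hz := hL L[i] (by simp)
      rw [show a + (i + 1) = a + 1 + i by omega, hd' i hi', hm, hr _ hz.1, hr _ hz.2]
      rfl

/-- Polynomial expressions in six variables. -/
inductive Expr6 where
  | var (i : Fin 6)
  | const (c : ℤ)
  | sum (e e' : Expr6)
  | diff (e e' : Expr6)
  | prod (e e' : Expr6)

/-- The value of an expression. -/
def Expr6.eval (v : Fin 6 → ℝ) : Expr6 → ℝ
  | .var i => v i
  | .const c => c
  | .sum e e' => e.eval v + e'.eval v
  | .diff e e' => e.eval v - e'.eval v
  | .prod e e' => e.eval v * e'.eval v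

/-- Code that computes an expression in the real registers `0, …, 5` into register `r`. -/
def Expr6.code : Expr6 → ℕ → List Instr
  | .var i, r => [.valConst r 0, .valAdd r r i]
  | .const c, r => [.valConst r c]
  | .sum e e', r => e.code r ++ (e'.code (r + 1) ++ [.valAdd r r (r + 1)])
  | .diff e e', r => e.code r ++ (e'.code (r + 1) ++ [.valSub r r (r + 1)])
  | .prod e e', r => e.code r ++ (e'.code (r + 1) ++ [.valMul r r (r + 1)])

/-- The code of `e` computes the value of `e`, without changing lower registers. -/
def Expr6.IsCorrect (e : Expr6) : Prop :=
  ∀ {r : ℕ}, 6 ≤ r → ∀ s : State,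
    (runList (e.code r) s).mem = s.mem ∧ (runList (e.code r) s).reg = s.reg ∧
    (∀ j < r, (runList (e.code r) s).val j = s.val j) ∧
    (runList (e.code r) s).val r = e.eval fun i => s.val i

theorem Expr6.IsCorrect.append {e e' : Expr6} (ih : e.IsCorrect) (ih' : e'.IsCorrect) {r : ℕ}
    (hr : 6 ≤ r) (s : State) :
    (runList (e.code r ++ e'.code (r + 1)) s).mem = s.mem ∧
    (runList (e.code r ++ e'.code (r + 1)) s).reg = s.reg ∧
    (∀ j < r, (runList (e.code r ++ e'.code (r + 1)) s).val j = s.val j) ∧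
    (runList (e.code r ++ e'.code (r + 1)) s).val r = (e.eval fun i => s.val i) ∧
    (runList (e.code r ++ e'.code (r + 1)) s).val (r + 1) = e'.eval fun i => s.val i := by
  obtain ⟨h₁, h₂, h₃, h₄⟩ := ih hr s
  obtain ⟨h₁', h₂', h₃', h₄'⟩ := ih' (r := r + 1) (by omega) (runList (e.code r) s)
  rw [runList_append]
  refine ⟨h₁'.trans h₁, h₂'.trans h₂, fun j hj => (h₃' j (by omega)).trans (h₃ j hj),
    (h₃' r (by omega)).trans h₄, h₄'.trans ?_⟩
  congr 1
  funext i
  exact h₃ i (by omega)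

theorem Expr6.isCorrect (e : Expr6) : e.IsCorrect := by
  induction e with
  | var i =>
    refine fun {r} hr s => ⟨rfl, rfl, fun j hj => ?_, ?_⟩
    · simp [Expr6.code, Instr.run, hj.ne]
    · simp [Expr6.code, Instr.run, Expr6.eval, show (i : ℕ) ≠ r by omega]
  | const c =>
    refine fun {r} hr s => ⟨rfl, rfl, fun j hj => ?_, ?_⟩
    · simp [Expr6.code, Instr.run, hj.ne]
    · simp [Expr6.code, Instr.run, Expr6.eval]
  | sum e e' ih ih' | diff e e' ih ih' | prod e e' ih ih' =>
    intro r hr s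
    have h := ih.append ih' hr s
    simp only [Expr6.code, ← List.append_assoc]
    rw [runList_append]
    generalize runList (e.code r ++ e'.code (r + 1)) s = s₁ at h
    obtain ⟨h₁, h₂, h₃, h₄, h₅⟩ := h
    refine ⟨h₁, h₂, fun j hj => ?_, ?_⟩
    · simp [Instr.run, hj.ne, h₃ j hj]
    · simp [Instr.run, h₄, h₅, Expr6.eval]

end Raises

/-! ### The decision procedure -/

/-- All pairs of members of a list of pairs. -/
def pairsOf : List (ℕ × ℕ) → List (ℕ × ℕ × ℕ × ℕ)
  | [] => []
  | z :: L => L.map (fun w => (z.1, z.2, w.1, w.2)) ++ pairsOf L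

theorem forall_pairsOf_iff (ρ : ℕ → ℕ) (L : List (ℕ × ℕ)) :
    (∀ q ∈ pairsOf L, ¬ PairEq ρ q) ↔ (L.map fun z => s(ρ z.1, ρ z.2)).Nodup := by
  induction L with
  | nil => simp [pairsOf]
  | cons z L ih =>
    simp only [pairsOf, List.forall_mem_append, ih, List.map_cons, List.nodup_cons,
      List.forall_mem_map]
    refine and_congr_left fun _ => ?_
    simp only [PairEq, List.mem_map, not_exists, not_and, eq_comm]

/-- The registers of the six pairs in the test, those of `U` and `Z` first. -/
def testPairs : List (ℕ × ℕ) := [(2, 3), (2, 4), (5, 6), (7, 8), (9, 10), (11, 12)]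

/-- The comparisons that show that the six pairs are distinct two-element sets. -/
def testQuads : List (ℕ × ℕ × ℕ × ℕ) :=
  testPairs.map (fun z => (z.1, z.2, z.1, z.1)) ++ pairsOf testPairs

/-- Comparing `s(a, b)` with the diagonal pair `s(a, a)` tests whether `a = b`, so one kind of
comparison serves both conditions. -/
theorem forall_testQuads_iff (ρ : ℕ → ℕ) : (∀ q ∈ testQuads, ¬ PairEq ρ q) ↔
    (ρ 2 ≠ ρ 3 ∧ ρ 2 ≠ ρ 4 ∧ ρ 5 ≠ ρ 6 ∧ ρ 7 ≠ ρ 8 ∧ ρ 9 ≠ ρ 10 ∧ ρ 11 ≠ ρ 12) ∧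
    [s(ρ 2, ρ 3), s(ρ 2, ρ 4), s(ρ 5, ρ 6), s(ρ 7, ρ 8), s(ρ 9, ρ 10), s(ρ 11, ρ 12)].Nodup := by
  rw [testQuads, List.forall_mem_append, forall_pairsOf_iff, List.forall_mem_map]
  refine and_congr ?_ Iff.rfl
  simp [testPairs, PairEq, eq_comm]

/-- The polynomial `g` as an expression. -/
def gExpr : Expr6 :=
  let U := .var 0
  let V := .var 1
  let W := .var 2
  let X := .var 3
  let Y := .var 4
  let Z := .var 5
  let term := fun A B C D E F : Expr6 =>
    Expr6.prod (.prod A B) (.diff (.sum A B) (.sum (.sum C D) (.sum E F)))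
  .prod (.const 2) (.sum (.sum (term U Z V Y X W) (.sum (term V Y U Z X W) (term X W U Z V Y)))
    (.sum (.sum (.prod (.prod U V) X) (.prod (.prod U Y) W))
      (.sum (.prod (.prod V W) Z) (.prod (.prod X Y) Z))))

/-- The expression groups `g` geometrically: one `term` for each couple of opposite sides, and one
product for each of the four triangles. -/
theorem eval_gExpr (v : Fin 6 → ℝ) :
    gExpr.eval v = g (v 0) (v 1) (v 2) (v 3) (v 4) (v 5) := by
  simp only [gExpr, Expr6.eval, g]
  push_cast
  ring

/-- Code for the value of `g` in the test. -/
def gCode : List Instr :=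
  distsCode 0 [(2, 3), (5, 6), (7, 8), (9, 10), (11, 12), (2, 4)] ++
    (gExpr.code 6 ++ [.valConst 7 0])

/-- The test for one choice of indices. -/
def gTest : Prog := unlessEq testQuads (valTest gCode 6 7)

/-- The registers hold indices for which the test fails. -/
def GFails (m : ℕ → ℝ) (ρ : ℕ → ℕ) : Prop :=
  (∀ q ∈ testQuads, ¬ PairEq ρ q) ∧
    g (memSqDist m (ρ 2) (ρ 3)) (memSqDist m (ρ 5) (ρ 6)) (memSqDist m (ρ 7) (ρ 8))
      (memSqDist m (ρ 9) (ρ 10)) (memSqDist m (ρ 11) (ρ 12)) (memSqDist m (ρ 2) (ρ 4)) = 0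

theorem quadBelow_testQuads : ∀ q ∈ testQuads, QuadBelow 13 q := by
  unfold QuadBelow
  decide

theorem raises_gTest (n : ℕ) (m : ℕ → ℝ) :
    Raises n m 13 13 (gCode.length + 3 + 10 * testQuads.length + 6) gTest (GFails m) := by
  refine Raises.unlessEq quadBelow_testQuads (Raises.valTest fun s h₁ hm => ?_) ?_
  · obtain ⟨hm', hr, -, hd⟩ := runList_distsCode
      [(2, 3), (5, 6), (7, 8), (9, 10), (11, 12), (2, 4)] (by decide) 0 h₁
    simp only [gCode, runList_append]
    generalize runList (distsCode 0 _) s = s₁ at *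
    obtain ⟨hm₂, hr₂, -, hv⟩ := gExpr.isCorrect le_rfl s₁
    generalize runList (gExpr.code 6) s₁ = s₂ at *
    refine ⟨hm₂.trans (hm'.trans hm), fun j hj => (congrFun hr₂ j).trans (hr j hj), ?_⟩
    have h0 := hd 0 (by decide)
    have h1 := hd 1 (by decide)
    have h2 := hd 2 (by decide)
    have h3 := hd 3 (by decide)
    have h4 := hd 4 (by decide)
    have h5 := hd 5 (by decide)
    simp only [hm, zero_add, List.getElem_cons_zero, List.getElem_cons_succ] at h0 h1 h2 h3 h4 h5
    rw [eval_gExpr] at hv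
    rw [← h0, ← h1, ← h2, ← h3, ← h4, ← h5]
    simp only [runList_cons, runList_nil, Instr.run, Function.update_self, Int.cast_zero]
    rw [Function.update_of_ne (by norm_num), hv]
    rfl
  · intro ρ ρ' h
    simp only [h 2 (by norm_num), h 3 (by norm_num), h 4 (by norm_num), h 5 (by norm_num),
      h 6 (by norm_num), h 7 (by norm_num), h 8 (by norm_num), h 9 (by norm_num),
      h 10 (by norm_num), h 11 (by norm_num), h 12 (by norm_num)]

/-- The comparisons that show that four indices are distinct. -/
def sideQuads : List (ℕ × ℕ × ℕ × ℕ) := pairsOf [(2, 2), (3, 3), (4, 4), (5, 5)]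

/-- A single index is encoded as a diagonal pair. -/
theorem forall_sideQuads_iff (ρ : ℕ → ℕ) :
    (∀ q ∈ sideQuads, ¬ PairEq ρ q) ↔ [ρ 2, ρ 3, ρ 4, ρ 5].Nodup := by
  rw [sideQuads, forall_pairsOf_iff]
  simp

/-- Code for the lengths of two opposite sides. -/
def sideCode : List Instr := distsCode 0 [(2, 3), (4, 5)]

/-- The additional test for four points. -/
def sideTest : Prog := whenConst 4 (unlessEq sideQuads (valTest sideCode 0 1))

/-- There are four points and the registers hold indices for which the additional test fails. -/
def SidesFail (m : ℕ → ℝ) (ρ : ℕ → ℕ) : Prop :=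
  ρ 0 = 4 ∧ (∀ q ∈ sideQuads, ¬ PairEq ρ q) ∧
    memSqDist m (ρ 2) (ρ 3) = memSqDist m (ρ 4) (ρ 5)

theorem quadBelow_sideQuads : ∀ q ∈ sideQuads, QuadBelow 13 q := by
  unfold QuadBelow
  decide

theorem dependsBelow_gFails (m : ℕ → ℝ) : DependsBelow 13 (GFails m) := by
  intro ρ ρ' h
  simp only [GFails, forall_testQuads_iff, h 2 (by norm_num), h 3 (by norm_num),
    h 4 (by norm_num), h 5 (by norm_num), h 6 (by norm_num), h 7 (by norm_num),
    h 8 (by norm_num), h 9 (by norm_num), h 10 (by norm_num), h 11 (by norm_num),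
    h 12 (by norm_num)]

theorem dependsBelow_sidesFail (m : ℕ → ℝ) : DependsBelow 13 (SidesFail m) := by
  intro ρ ρ' h
  simp only [SidesFail, forall_sideQuads_iff, h 0 (by norm_num), h 2 (by norm_num),
    h 3 (by norm_num), h 4 (by norm_num), h 5 (by norm_num)]

theorem raises_sideTest (n : ℕ) (m : ℕ → ℝ) :
    Raises n m 13 13 (sideCode.length + 3 + 10 * sideQuads.length + 6 + 3) sideTest
      (SidesFail m) := by
  refine Raises.whenConst (Raises.unlessEq quadBelow_sideQuads
    (Raises.valTest fun s h₁ hm => ?_) ?_) ?_ 4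
  · obtain ⟨hm', hr, -, hd⟩ := runList_distsCode [(2, 3), (4, 5)] (by decide) 0 h₁
    refine ⟨hm'.trans hm, hr, ?_⟩
    have h0 := hd 0 (by decide)
    have h1 := hd 1 (by decide)
    simp only [hm, zero_add, List.getElem_cons_zero, List.getElem_cons_succ] at h0 h1
    rw [sideCode, h0, h1]
  · intro ρ ρ' h
    simp only [h 2 (by norm_num), h 3 (by norm_num), h 4 (by norm_num), h 5 (by norm_num)]
  · intro ρ ρ' h
    simp only [forall_sideQuads_iff, h 2 (by norm_num), h 3 (by norm_num), h 4 (by norm_num),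
      h 5 (by norm_num)]

/-! ### Correctness and running time of the whole program -/

/-- The decision procedure. -/
def decider : Prog :=
  .seq (.instr (.regConst 1 1))
    (.seq (nest 2 11 (.seq gTest sideTest))
      (.seq (.instr (.regConst 14 0))
        (.branch (.regEq 13 14) (.instr (.regConst 0 1)) (.instr (.regConst 0 0)))))

theorem memSqDist_initState {n : ℕ} (p : Config 2 n) (i j : Fin n) :
    memSqDist (initState p).mem i j = sqDist p i j := by
  have h0 : ∀ i : Fin n, (initState p).mem (i + i) = p i 0 := fun i => by
    have h1 : ((i : ℕ) + i) / 2 = i := by omega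
    have h2 : ((i : ℕ) + i) % 2 = 0 := by omega
    simp [initState, h1, h2]
  have h1 : ∀ i : Fin n, (initState p).mem (i + i + 1) = p i 1 := fun i => by
    have h1 : ((i : ℕ) + i + 1) / 2 = i := by omega
    have h2 : ((i : ℕ) + i + 1) % 2 = 1 := by omega
    simp [initState, h1, h2]
  simp [memSqDist, h0, h1, sqDist, EuclideanSpace.norm_sq_eq]

theorem nodup_map_val_pairs {n : ℕ} (L : List (Sym2 (Fin n))) :
    (L.map (Sym2.map (Fin.val (n := n)))).Nodup ↔ L.Nodup :=
  List.nodup_map_iff (Sym2.map.injective Fin.val_injective)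

theorem not_passesTest_iff {n : ℕ} (p : Config 2 n) (ρ : ℕ → ℕ) :
    ¬ PassesTest p ↔ SomeBelow n 2 11 (GFails (initState p).mem) ρ := by
  constructor
  · intro h
    unfold PassesTest at h
    push Not at h
    obtain ⟨i₀, i₁, i₂, j₁, j₂, k₁, k₂, l₁, l₂, m₁, m₂, hi₁, hi₂, hj, hk, hl, hm, hnd, hg⟩ := h
    -- Registers 2 to 12 are the eleven loop counters; the default 0 fills registers that no
    -- condition reads.
    refine ⟨fun j => [ρ 0, ρ 1, i₀, i₁, i₂, j₁, j₂, k₁, k₂, l₁, l₂, m₁, m₂].getD j 0,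
      fun j hj => ?_, fun j hj hj' => ?_, ?_, ?_⟩
    · interval_cases j <;> rfl
    · interval_cases j <;> exact Fin.isLt _
    · rw [forall_testQuads_iff]
      refine ⟨⟨Fin.val_injective.ne hi₁, Fin.val_injective.ne hi₂, Fin.val_injective.ne hj,
        Fin.val_injective.ne hk, Fin.val_injective.ne hl, Fin.val_injective.ne hm⟩, ?_⟩
      exact (nodup_map_val_pairs _).2 hnd
    · simpa [memSqDist_initState] using hg
  · rintro ⟨σ, -, hlt, hq, hg⟩ hp
    rw [forall_testQuads_iff] at hq
    obtain ⟨⟨hi₁, hi₂, hj, hk, hl, hm⟩, hnd⟩ := hq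
    have hF : ∀ j, 2 ≤ j → j < 13 → ∃ x : Fin n, (x : ℕ) = σ j := fun j hj hj' =>
      ⟨⟨σ j, hlt j hj hj'⟩, rfl⟩
    obtain ⟨i₀, e2⟩ := hF 2 (by norm_num) (by norm_num)
    obtain ⟨i₁, e3⟩ := hF 3 (by norm_num) (by norm_num)
    obtain ⟨i₂, e4⟩ := hF 4 (by norm_num) (by norm_num)
    obtain ⟨j₁, e5⟩ := hF 5 (by norm_num) (by norm_num)
    obtain ⟨j₂, e6⟩ := hF 6 (by norm_num) (by norm_num)
    obtain ⟨k₁, e7⟩ := hF 7 (by norm_num) (by norm_num)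
    obtain ⟨k₂, e8⟩ := hF 8 (by norm_num) (by norm_num)
    obtain ⟨l₁, e9⟩ := hF 9 (by norm_num) (by norm_num)
    obtain ⟨l₂, e10⟩ := hF 10 (by norm_num) (by norm_num)
    obtain ⟨m₁, e11⟩ := hF 11 (by norm_num) (by norm_num)
    obtain ⟨m₂, e12⟩ := hF 12 (by norm_num) (by norm_num)
    rw [← e2, ← e3, ← e4, ← e5, ← e6, ← e7, ← e8, ← e9, ← e10, ← e11, ← e12] at hg hnd
    rw [← e2, ← e3] at hi₁
    rw [← e2, ← e4] at hi₂
    rw [← e5, ← e6] at hj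
    rw [← e7, ← e8] at hk
    rw [← e9, ← e10] at hl
    rw [← e11, ← e12] at hm
    simp only [memSqDist_initState] at hg
    exact hp i₀ i₁ i₂ j₁ j₂ k₁ k₂ l₁ l₂ m₁ m₂ (ne_of_apply_ne _ hi₁) (ne_of_apply_ne _ hi₂)
      (ne_of_apply_ne _ hj) (ne_of_apply_ne _ hk) (ne_of_apply_ne _ hl) (ne_of_apply_ne _ hm)
      ((nodup_map_val_pairs
        [s(i₀, i₁), s(i₀, i₂), s(j₁, j₂), s(k₁, k₂), s(l₁, l₂), s(m₁, m₂)]).1 hnd) hg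

theorem not_oppositeSidesDiffer_iff {n : ℕ} (p : Config 2 n) {ρ : ℕ → ℕ} (h₀ : ρ 0 = n) :
    ¬ OppositeSidesDiffer p ↔ SomeBelow n 2 11 (SidesFail (initState p).mem) ρ := by
  have hmap : ∀ L : List (Fin n), (L.map (Fin.val (n := n))).Nodup ↔ L.Nodup := fun L =>
    List.nodup_map_iff Fin.val_injective
  constructor
  · intro h
    unfold OppositeSidesDiffer at h
    push Not at h
    obtain ⟨h4, i, j, k, l, hnd, he⟩ := h
    refine ⟨fun a => [ρ 0, ρ 1, i, j, k, l].getD a 0,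
      fun a ha => ?_, fun a ha ha' => ?_, h₀.trans h4, ?_, ?_⟩
    · interval_cases a <;> rfl
    · interval_cases a
      iterate 4 exact Fin.isLt _
      -- The unused counters 6 to 12 get the value 0, which is below `n` because a label exists.
      all_goals exact Fin.pos i
    · rw [forall_sideQuads_iff]
      exact (hmap _).2 hnd
    · simpa [memSqDist_initState] using he
  · rintro ⟨σ, h₁, hlt, h4, hq, he⟩ hp
    rw [forall_sideQuads_iff] at hq
    have hF : ∀ j, 2 ≤ j → j < 13 → ∃ x : Fin n, (x : ℕ) = σ j := fun j hj hj' =>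
      ⟨⟨σ j, hlt j hj hj'⟩, rfl⟩
    obtain ⟨i, e2⟩ := hF 2 (by norm_num) (by norm_num)
    obtain ⟨j, e3⟩ := hF 3 (by norm_num) (by norm_num)
    obtain ⟨k, e4⟩ := hF 4 (by norm_num) (by norm_num)
    obtain ⟨l, e5⟩ := hF 5 (by norm_num) (by norm_num)
    rw [← e2, ← e3, ← e4, ← e5] at he hq
    simp only [memSqDist_initState] at he
    exact hp (by rw [← h₀, ← h₁ 0 (by norm_num), h4]) i j k l ((hmap [i, j, k, l]).1 hq) he

theorem someBelow_or {n k d : ℕ} {P Q : (ℕ → ℕ) → Prop} (ρ : ℕ → ℕ) :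
    SomeBelow n k d (fun ρ => P ρ ∨ Q ρ) ρ ↔ SomeBelow n k d P ρ ∨ SomeBelow n k d Q ρ := by
  simp only [SomeBelow, ← exists_or, ← and_or_left]

/-- The constant is made of lengths of fixed code, 4 for each of the eleven loops, and 4 for the
steps outside them. -/
theorem exists_decidesWithin_decider : ∃ C : ℕ, ∀ n : ℕ, 1 ≤ n →
    DecidesWithin decider {p : Config 2 n | PassesTest p ∧ OppositeSidesDiffer p}
      (C * n ^ 11) := by
  refine ⟨gCode.length + 3 + 10 * testQuads.length + 6 +
    (sideCode.length + 3 + 10 * sideQuads.length + 6 + 3) + 4 * 11 + 4, fun n hn p => ?_⟩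
  generalize hT : gCode.length + 3 + 10 * testQuads.length + 6 +
    (sideCode.length + 3 + 10 * sideQuads.length + 6 + 3) = T
  have hbody := (raises_gTest n (initState p).mem).seq (raises_sideTest n (initState p).mem)
    (dependsBelow_sidesFail _) (by norm_num)
  rw [hT] at hbody
  have hnest := Raises.nest (k := 2) hn 11 hbody (fun ρ ρ' h =>
    or_congr (dependsBelow_gFails _ ρ ρ' h) (dependsBelow_sidesFail _ ρ ρ' h)) (by norm_num) le_rfl
  let s₁ := (Instr.regConst 1 1).run (initState p)
  have h₀ : s₁.reg 0 = n := by simp [s₁, Instr.run, initState]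
  have h13 : s₁.reg 13 = 0 := by simp [s₁, Instr.run, initState]
  obtain ⟨t, s₂, he, ht, -, -, hf⟩ := hnest s₁ h₀ (by simp [s₁, Instr.run]) rfl
  have hiff : s₂.reg 13 = 0 ↔ PassesTest p ∧ OppositeSidesDiffer p := by
    rw [hf, someBelow_or, ← not_passesTest_iff, ← not_oppositeSidesDiffer_iff p h₀, not_or,
      not_not, not_not]
    exact and_iff_right h13
  have hpow : 1 ≤ n ^ 11 := Nat.one_le_pow _ _ hn
  have htime : 1 + (t + (1 + (1 + 1))) ≤ (T + 4 * 11 + 4) * n ^ 11 := by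
    calc 1 + (t + (1 + (1 + 1))) ≤ (T + 4 * 11) * n ^ 11 + 4 * n ^ 11 :=
          le_trans (by omega) (add_le_add ht (Nat.mul_le_mul_left 4 hpow))
      _ = (T + 4 * 11 + 4) * n ^ 11 := (add_mul _ _ _).symm
  let s₃ := (Instr.regConst 14 0).run s₂
  have h14 : s₃.reg 14 = 0 := by simp [s₃, Instr.run]
  have h13' : s₃.reg 13 = s₂.reg 13 := by simp [s₃, Instr.run]
  by_cases h : PassesTest p ∧ OppositeSidesDiffer p
  · refine ⟨_, _, .seq (.instr _ _) (.seq he (.seq (.instr _ _)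
      (.branchTrue ?_ (.instr _ _)))), htime, fun _ => ?_, fun h' => absurd h h'⟩
    · exact (h13'.trans (hiff.2 h)).trans h14.symm
    · simp [Instr.run]
  · refine ⟨_, _, .seq (.instr _ _) (.seq he (.seq (.instr _ _)
      (.branchFalse ?_ (.instr _ _)))), htime, fun h' => absurd h' h, fun _ => ?_⟩
    · exact fun h' => h (hiff.1 (h13'.symm.trans (Eq.trans h' h14)))
    · simp [Instr.run]

end DistRec

theorem mainTheorem3 :
    ∃ Ω : (n : ℕ) → Set (DistRec.Config 2 n),
      (∀ n : ℕ, 1 ≤ n →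
        IsOpen (Ω n) ∧ Dense (Ω n) ∧ ∀ p ∈ Ω n, DistRec.Reconstructible p) ∧
      (∀ n : ℕ, 5 ≤ n → Ω n = {p | DistRec.PassesTest p}) ∧
      ∃ (A : DistRec.Prog) (C : ℕ), ∀ n : ℕ, 1 ≤ n →
        DistRec.DecidesWithin A (Ω n) (C * n ^ 11) := by
  refine ⟨fun n => {p | DistRec.PassesTest p ∧ DistRec.OppositeSidesDiffer p},
    fun n _ => ⟨(DistRec.isOpenDense_and n).1, (DistRec.isOpenDense_and n).2,
      fun p hp => DistRec.reconstructible_of_passesTest hp.1 hp.2⟩, fun n hn => ?_,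
    DistRec.decider, DistRec.exists_decidesWithin_decider⟩
  ext p
  -- `OppositeSidesDiffer` has the premise `n = 4`, so it is vacuous here.
  exact and_iff_left fun h => absurd h (by omega)
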